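/- Let $K$ be a compact metric space and $C(K)$ the Banach algebra of continuous functions $K\to\mathbb C$ with $\|\cdot\|_\infty$. **Fixed data.** Let $(m_j,n_j)_{j\ge1}$ be positive even integers with $m_1\ge 8$, $m_{j+1}\ge m_j^2$, $n_1\ge m_1^2$, $n_{j+1}\ge(16n_j)^{\log_2 m_{j+1}}$. Let $\mathcal A\subset C(K)$ be countable, dense and closed under linear combinations with coefficients in $\mathbb Q+i\mathbb Q$; let $\{\phi\in\mathcal A:\|\phi\|_\infty\le1\}=\{\phi_1,\phi_2,\dots\}$. For $n\ge1$ put $$\mathcal B_n=\Big\{\theta^k\phi_{i_1}\cdots\phi_{i_k}:k\ge1,\ 0\le\theta\le\tfrac n{n+1},\ 1\le i_1,\dots,i_k\le n\Big\},\qquad \varrho(\kappa,\kappa')=\sum_{n\ge1}2^{-n}\max_{\phi\in\mathcal B_n}|\phi(\kappa)-\phi(\kappa')|.$$ Let $K_1\subset K_2\subset\cdots$ be finite subsets of $K$ such that every point of $K$ is within $\varrho$-distance $m_n^{-1}2^{-(n+1)}$ of $K_n$. Put $\mathbb D_n=\{(k_1/2^n)e^{2\pi i k_2/2^n}:1\le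 k_1,k_2\le2^n\}$. Intervals are non-empty intervals of positive integers. **The index sets.** Define recursively sets $\bar\Delta_n$, with $\bar\Gamma_n=\bar\Delta_1\cup\dots\cup\bar\Delta_n$ and $\bar\Gamma_0=\emptyset$: the elements of $\bar\Delta_n$ are the tuples * $(n,\kappa)$ with $\kappa\in K_n$, of weight $0$; * $(n,I,\eta,\lambda,m_j^{-1},\kappa)$ with $I\subset[1,n-1]$ an interval, $\eta\in\bar\Gamma_{n-1}$, $\lambda\in\mathbb D_n$, $1\le j\le n$, $\kappa\in K_n$, of weight $m_j^{-1}$ and age $1$; * $(n,\xi,I,\eta,\lambda,m_j^{-1},\kappa)$, where moreover $n\ge 3$, $\xi\in\bar\Gamma_{n-2}$ has weight $m_j^{-1}$ and age less than $n_j$, and $I\subset[\mathrm{rank}(\xi)+1,n-1]$, of weight $m_j^{-1}$ and age one more than that of $\xi$. For such a tuple $\gamma$, $\mathrm{rank}(\gamma)=n$ is its first and $\kappa(\gamma)$ its last coordinate. Put $\bar\Gamma=\bigcup_n\bar\Delta_n$ and fix an injection $\sigma:\bar\Gamma\to\{1,2,\dots\}$ with $m_{4\sigma(\gamma)}>2^{\mathrm{rank}(\gamma)}$.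 Put $\mathrm{weight}(I,\gamma)=0$ if $\mathrm{rank}(\gamma)\le\min I$ and $\mathrm{weight}(I,\gamma)=\mathrm{weight}(\gamma)$ otherwise. Let $\Gamma\subset\bar\Gamma$ consist of all $(n,\kappa)\in\bar\Gamma$; of the tuples of the second kind with $\eta\in\Gamma$ and, if $j$ is odd, $\mathrm{weight}(\eta)=m_{4i-2}^{-1}$ for some $i\ge1$; and of the tuples of the third kind with $\xi,\eta\in\Gamma$, $\varrho(\kappa(\xi),\kappa)\le m_j^{-1}2^{-\mathrm{rank}(\xi)}$, $\varrho(\kappa(\eta),\kappa)\le2^{-\mathrm{rank}(\xi)}$, and $\mathrm{weight}(I,\eta)\le2^{-\mathrm{rank}(\xi)}$ if $j$ is even, $\mathrm{weight}(\eta)=m_{4\sigma(\xi)}^{-1}$ if $j$ is odd. Put $\Gamma_n=\{\gamma\in\Gamma:\mathrm{rank}(\gamma)\le n\}$. **The space.** Let $r_n$ be the restriction of functions to $\Gamma_n$. The extension operators $i_n:\ell_\infty(\Gamma_n)\to\ell_\infty(\Gamma)$ are determined by $i_n(x)(\gamma)=x(\gamma)$ for $\gamma\in\Gamma_n$ and $i_n(x)(\gamma)=c_\gamma^*(i_n(x))$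 for $\mathrm{rank}(\gamma)>n$, where, with $P_{[1,k]}=i_kr_k$, $P_{[a,b]}=P_{[1,b]}-P_{[1,a-1]}$ and $P_{[1,0]}=0$, the functional $c_\gamma^*$ is $0$, $\;m_j^{-1}\lambda\,e_\eta^*\circ P_I$, or $\;e_\xi^*+m_j^{-1}\lambda\,e_\eta^*\circ P_I$ for $\gamma$ of the first, second or third kind. Let $\mathfrak X_{C(K)}$ be the closure of $\bigcup_n i_n(\ell_\infty(\Gamma_n))$ in $\ell_\infty(\Gamma)$, let $d_\gamma=i_{\mathrm{rank}(\gamma)}(e_\gamma)$ for $\gamma\in\Gamma$, and let $P_{[N,\infty)}=\mathrm{id}-P_{[1,N-1]}$. For $\phi\in C(K)$ let $\hat\phi$ be the linear operator on the span of the $d_\gamma$ with $\hat\phi(d_\gamma)=\phi(\kappa(\gamma))d_\gamma$; the same symbol denotes its bounded extension to $\mathfrak X_{C(K)}$ if there is one. For an equivalent norm $\nu$ on $\mathfrak X_{C(K)}$, $\mathrm{Cal}(\mathfrak X_{C(K)},\nu)$ is the algebra of bounded operators modulo the compact ones, with the quotient of the operator norm induced by $\nu$. **Proposition.** For all choices of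 the data above, there are an equivalent norm $|||\cdot|||$ on $\mathfrak X_{C(K)}$ and positive integers $N(1)\le N(2)\le\cdots$ such that: 1. For all $n\ge1$ and $\phi\in\mathcal B_n$ the operator $\hat\phi$ is bounded, and $$|||x|||=\sup\big(\{\|x\|\}\cup\{\|P_{[N(n),\infty)}\hat\phi x\|:n\ge1,\ \phi\in\mathcal B_n\}\big)\qquad(x\in\mathfrak X_{C(K)}).$$ 2. For every $\varrho$-Lipschitz $\phi:K\to\mathbb C$ the operator $\hat\phi$ is bounded, and the map $\phi\mapsto[\hat\phi]$ on these functions has a unique continuous extension $\Psi:C(K)\to\mathrm{Cal}(\mathfrak X_{C(K)},|||\cdot|||)$. 3. $\Psi$ is a unital algebra homomorphism, and $\|\Psi(\phi)\|=\|\phi\|_\infty$ for all $\phi\in C(K)$. -/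

import Mathlib

open scoped ENNReal

noncomputable section

namespace CKCalkin

universe u

/-! ### Parameters of the construction -/

/-- The double sequence `(m_j, n_j)_{j ≥ 1}` of positive even integers (the values at `j = 0` play
no role). -/
structure WeightSeq where
  m : ℕ → ℕ
  n : ℕ → ℕ
  m_pos : ∀ j, 1 ≤ j → 0 < m j
  m_even : ∀ j, 1 ≤ j → Even (m j)
  n_pos : ∀ j, 1 ≤ j → 0 < n j
  n_even : ∀ j, 1 ≤ j → Even (n j)
  m_one : 8 ≤ m 1
  m_succ : ∀ j, 1 ≤ j → m j ^ 2 ≤ m (j + 1)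
  n_one : m 1 ^ 2 ≤ n 1
  n_succ : ∀ j, 1 ≤ j →
    (16 * (n j : ℝ)) ^ Real.logb 2 (m (j + 1) : ℝ) ≤ (n (j + 1) : ℝ)

/-- The complex numbers with rational real and imaginary parts. -/
def gaussRat : Set ℂ := {z | ∃ a b : ℚ, z = (a : ℂ) + (b : ℂ) * Complex.I}

/-- `𝔻_n = {(k₁/2ⁿ) e^{2πi k₂/2ⁿ} : k₁, k₂ = 1, …, 2ⁿ}`. -/
def disc (n : ℕ) : Set ℂ :=
  {z | ∃ k₁ k₂ : ℕ, 1 ≤ k₁ ∧ k₁ ≤ 2 ^ n ∧ 1 ≤ k₂ ∧ k₂ ≤ 2 ^ n ∧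
    z = ((k₁ : ℂ) / 2 ^ n) * Complex.exp (((k₂ : ℂ) / 2 ^ n) * (2 * Real.pi) * Complex.I)}

section Metric

variable {K : Type u} [TopologicalSpace K]

/-- `𝓑_n = {θ^k φ_{i₁} ⋯ φ_{i_k} : k ≥ 1, 0 ≤ θ ≤ n/(n+1), 1 ≤ i₁, …, i_k ≤ n}`. -/
def semigroupB (enum : ℕ → C(K, ℂ)) (n : ℕ) : Set C(K, ℂ) :=
  {f | ∃ k : ℕ, 1 ≤ k ∧ ∃ θ : ℝ, 0 ≤ θ ∧ θ ≤ (n : ℝ) / (n + 1) ∧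
    ∃ i : Fin k → ℕ, (∀ t, 1 ≤ i t ∧ i t ≤ n) ∧ f = ((θ : ℂ) ^ k) • ∏ t, enum (i t)}

/-- `ϱ(κ, κ') = ∑_{n ≥ 1} 2⁻ⁿ max {|φ(κ) - φ(κ')| : φ ∈ 𝓑_n}`. -/
def rho (enum : ℕ → C(K, ℂ)) (x y : K) : ℝ :=
  ∑' n : ℕ, ((2 : ℝ) ^ (n + 1))⁻¹ *
    sSup ((fun φ : C(K, ℂ) => ‖φ x - φ y‖) '' semigroupB enum (n + 1))

end Metric

/-- The objects that are fixed before the construction starts. -/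
structure Params (K : Type u) [MetricSpace K] [CompactSpace K] extends WeightSeq where
  /-- a countable dense subset of `C(K)`, closed under Gaussian rational linear combinations -/
  A : Set C(K, ℂ)
  A_countable : A.Countable
  A_dense : Dense A
  A_comb : ∀ f ∈ A, ∀ g ∈ A, ∀ a ∈ gaussRat, ∀ b ∈ gaussRat, a • f + b • g ∈ A
  /-- an enumeration `φ₁, φ₂, …` of `{φ ∈ A : ‖φ‖ ≤ 1}` -/
  enum : ℕ → C(K, ℂ)
  enum_image : enum '' Set.Ici 1 = {f | f ∈ A ∧ ‖f‖ ≤ 1}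
  /-- the increasing sequence `K₁ ⊂ K₂ ⊂ …` of finite nets of `(K, ϱ)` -/
  net : ℕ → Finset K
  net_mono : ∀ n, 1 ≤ n → net n ⊆ net (n + 1)
  net_net : ∀ n, 1 ≤ n → ∀ x : K, ∃ y ∈ net n,
    rho enum x y ≤ (m n : ℝ)⁻¹ * ((2 : ℝ) ^ (n + 1))⁻¹

/-! ### The index set -/

/-- Raw tuples `(n, κ)`, `(n, I, η, λ, m_j⁻¹, κ)` and `(n, ξ, I, η, λ, m_j⁻¹, κ)`. The (non-empty)
interval `I = [a, b]` is recorded through its end points and the weight `m_j⁻¹` through `j`. -/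
inductive Node (K : Type u) : Type u
  | base (n : ℕ) (κ : K) : Node K
  | age1 (n a b : ℕ) (η : Node K) (l : ℂ) (j : ℕ) (κ : K) : Node K
  | succ (n : ℕ) (ξ : Node K) (a b : ℕ) (η : Node K) (l : ℂ) (j : ℕ) (κ : K) : Node K

namespace Node

variable {K : Type u}

/-- The first coordinate. -/
def rank : Node K → ℕ
  | base n _ => n
  | age1 n _ _ _ _ _ _ => n
  | succ n _ _ _ _ _ _ _ => n

/-- The last coordinate. -/
def kappa : Node K → K
  | base _ κ => κ
  | age1 _ _ _ _ _ _ κ => κ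
  | succ _ _ _ _ _ _ _ κ => κ

/-- The age; the value `0` for the tuples `(n, κ)`, whose age is undefined, is never used. -/
def age : Node K → ℕ
  | base _ _ => 0
  | age1 _ _ _ _ _ _ _ => 1
  | succ _ ξ _ _ _ _ _ _ => age ξ + 1

end Node

variable {K : Type u} [MetricSpace K] [CompactSpace K]

namespace Params

variable (p : Params K)

/-- The weight: `0` for `(n, κ)`, and `m_j⁻¹` for the other tuples. -/
def weight : Node K → ℝ
  | .base _ _ => 0
  | .age1 _ _ _ _ _ j _ => (p.m j : ℝ)⁻¹
  | .succ _ _ _ _ _ _ j _ => (p.m j : ℝ)⁻¹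

/-- `weight(I, γ)` for an interval `I` with minimum `a`. -/
def intervalWeight (a : ℕ) (γ : Node K) : ℝ := if γ.rank ≤ a then 0 else p.weight γ

/-- Membership in the index set `Γ̄ = ⋃ Δ̄_n` of the unconstrained space. Here `n` is the rank of
the tuple, so that for `n = N + 1` the conditions `η ∈ Γ̄_N`, `ξ ∈ Γ̄_{N-1}` become
`η ∈ Γ̄, rank η < n` and `ξ ∈ Γ̄, rank ξ + 1 < n`. -/
def IsBarNode : Node K → Prop
  | .base n κ => 1 ≤ n ∧ κ ∈ p.net n
  | .age1 n a b η l j κ =>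
      (1 ≤ a ∧ a ≤ b ∧ b < n) ∧ IsBarNode η ∧ η.rank < n ∧ l ∈ disc n ∧ 1 ≤ j ∧ j ≤ n ∧
        κ ∈ p.net n
  | .succ n ξ a b η l j κ =>
      IsBarNode ξ ∧ ξ.rank + 1 < n ∧ p.weight ξ = (p.m j : ℝ)⁻¹ ∧ ξ.age < p.n j ∧
        (ξ.rank < a ∧ a ≤ b ∧ b < n) ∧ IsBarNode η ∧ η.rank < n ∧ l ∈ disc n ∧ 1 ≤ j ∧ j ≤ n ∧
        κ ∈ p.net n

end Params

/-- A coding function: an injection `σ : Γ̄ → {1, 2, …}` with `m_{4σ(γ)} > 2^{rank γ}`. -/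
structure Coding (p : Params K) where
  σ : Node K → ℕ
  inj : Set.InjOn σ {γ | p.IsBarNode γ}
  pos : ∀ γ, p.IsBarNode γ → 1 ≤ σ γ
  large : ∀ γ, p.IsBarNode γ → 2 ^ γ.rank < p.m (4 * σ γ)

section Space

variable {p : Params K} (c : Coding p)

/-- Membership in the index set `Γ = ⋃ Δ_n` of the space `𝔛_{C(K)}`. -/
def IsNode : Node K → Prop
  | .base n κ => p.IsBarNode (.base n κ)
  | .age1 n a b η l j κ =>
      p.IsBarNode (.age1 n a b η l j κ) ∧ IsNode η ∧
        (Even j ∨ (Odd j ∧ ∃ i, 1 ≤ i ∧ p.weight η = (p.m (4 * i - 2) : ℝ)⁻¹))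
  | .succ n ξ a b η l j κ =>
      p.IsBarNode (.succ n ξ a b η l j κ) ∧ IsNode ξ ∧ IsNode η ∧
        rho p.enum ξ.kappa κ ≤ (p.m j : ℝ)⁻¹ * ((2 : ℝ) ^ ξ.rank)⁻¹ ∧
        rho p.enum η.kappa κ ≤ ((2 : ℝ) ^ ξ.rank)⁻¹ ∧
        ((Even j ∧ p.intervalWeight a η ≤ ((2 : ℝ) ^ ξ.rank)⁻¹) ∨
          (Odd j ∧ p.weight η = (p.m (4 * c.σ ξ) : ℝ)⁻¹))

/-- The index set `Γ`. -/
abbrev Gam : Type u := {γ : Node K // IsNode c γ}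

/-- The extension functional `c*_γ` (composed with restriction to lower ranks), where `P k` is
the projection `P_{[1,k]}`, so that `P b - P (a - 1)` is `P_I` for `I = [a, b]`:
`0`, `m_j⁻¹ λ e*_η ∘ P_I`, or `e*_ξ + m_j⁻¹ λ e*_η ∘ P_I`. -/
def extFun (P : ℕ → (Gam c → ℂ) →ₗ[ℂ] (Gam c → ℂ)) : Gam c → ((Gam c → ℂ) →ₗ[ℂ] ℂ)
  | ⟨.base _ _, _⟩ => 0
  | ⟨.age1 _ a b η l j _, h⟩ =>
      ((p.m j : ℂ)⁻¹ * l) • (LinearMap.proj (⟨η, h.2.1⟩ : Gam c) ∘ₗ (P b - P (a - 1)))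
  | ⟨.succ _ ξ a b η l j _, h⟩ =>
      LinearMap.proj (⟨ξ, h.2.1⟩ : Gam c) +
      ((p.m j : ℂ)⁻¹ * l) • (LinearMap.proj (⟨η, h.2.2.1⟩ : Gam c) ∘ₗ (P b - P (a - 1)))

/-- The projections `P_k^{(n)} = i_{k,n} ∘ r_k` available after step `n`, defined by recursion on
`n`. A function on `Γ_n` is regarded as a function on `Γ` vanishing outside `Γ_n`. Step `n + 1`
applies the extension operator `i_{n,n+1}` with `i_{n,n+1}(y)(γ) = c*_γ(y)` for `γ ∈ Δ_{n+1}`. -/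
def stageProj : ℕ → ℕ → ((Gam c → ℂ) →ₗ[ℂ] (Gam c → ℂ))
  | 0, _ => 0
  | n + 1, k => LinearMap.pi fun γ =>
      if γ.1.rank ≤ n then LinearMap.proj γ ∘ₗ stageProj n k
      else if γ.1.rank = n + 1 then
        (if n + 1 ≤ k then LinearMap.proj γ else extFun c (stageProj n) γ ∘ₗ stageProj n k)
      else 0

/-- The projection `P_{[1,k]} = i_k ∘ r_k`, where `i_k = lim_n i_{k,n}`; the value at `γ` of
`i_{k,n}` does not change any more once `n ≥ rank γ`. -/
def projFun (k : ℕ) : (Gam c → ℂ) →ₗ[ℂ] (Gam c → ℂ) :=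
  LinearMap.pi fun γ => LinearMap.proj γ ∘ₗ stageProj c γ.1.rank k

variable {c}

theorem one_le_rank : ∀ γ : Gam c, 1 ≤ γ.1.rank
  | ⟨.base _ _, h⟩ => h.1
  | ⟨.age1 _ _ _ _ _ _ _, h⟩ => by
      have := h.1.1
      simp only [Node.rank]; omega
  | ⟨.succ _ _ _ _ _ _ _ _, h⟩ => by
      have := h.1.2.1
      simp only [Node.rank]; omega

theorem stageProj_succ (n k : ℕ) (x : Gam c → ℂ) (γ : Gam c) :
    stageProj c (n + 1) k x γ =
      if γ.1.rank ≤ n then stageProj c n k x γ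
      else if γ.1.rank = n + 1 then
        (if n + 1 ≤ k then x γ else extFun c (stageProj c n) γ (stageProj c n k x))
      else 0 := by
  simp only [stageProj, LinearMap.pi_apply]
  split_ifs <;> simp

theorem stageProj_eq (n k : ℕ) (x : Gam c → ℂ) (γ : Gam c) (h : γ.1.rank ≤ n) :
    stageProj c n k x γ = projFun c k x γ := by
  induction n with
  | zero => have := one_le_rank γ; omega
  | succ n ih =>
    rcases Nat.lt_or_ge n γ.1.rank with h1 | h1
    · have : γ.1.rank = n + 1 := by omega
      simp [projFun, this]
    · rw [stageProj_succ, if_pos h1, ih h1]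

theorem projFun_of_le (k : ℕ) (x : Gam c → ℂ) (γ : Gam c) (h : γ.1.rank ≤ k) :
    projFun c k x γ = x γ := by
  obtain ⟨n, hn⟩ : ∃ n, γ.1.rank = n + 1 := ⟨γ.1.rank - 1, by have := one_le_rank γ; omega⟩
  have : projFun c k x γ = stageProj c (n + 1) k x γ := by simp [projFun, hn]
  rw [this, stageProj_succ, if_neg (by omega), if_pos hn, if_pos (by omega)]

/-- `extFun` only looks at the values of the projections below the rank of `γ`. -/
theorem extFun_congr (P Q : ℕ → (Gam c → ℂ) →ₗ[ℂ] (Gam c → ℂ)) (x y : Gam c → ℂ) :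
    ∀ γ : Gam c, (∀ δ : Gam c, δ.1.rank < γ.1.rank → x δ = y δ) →
      (∀ δ : Gam c, ∀ k, δ.1.rank < γ.1.rank → P k x δ = Q k y δ) →
      extFun c P γ x = extFun c Q γ y
  | ⟨.base _ _, _⟩, _, _ => rfl
  | ⟨.age1 n a b η l j κ, h⟩, _, h2 => by
      have h3 : η.rank < n := h.1.2.2.1
      have e := fun k => h2 ⟨η, h.2.1⟩ k h3
      simp only [extFun, LinearMap.smul_apply, LinearMap.comp_apply, LinearMap.sub_apply,
        LinearMap.proj_apply, Pi.sub_apply, e]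
  | ⟨.succ n ξ a b η l j κ, h⟩, h1, h2 => by
      have h3 : η.rank < n := h.1.2.2.2.2.2.2.1
      have h4 : ξ.rank < n := by have := h.1.2.1; omega
      have e := fun k => h2 ⟨η, h.2.2.1⟩ k h3
      have e' := h1 ⟨ξ, h.2.1⟩ h4
      simp only [extFun, LinearMap.smul_apply, LinearMap.comp_apply, LinearMap.sub_apply,
        LinearMap.proj_apply, Pi.sub_apply, LinearMap.add_apply, e, e']

/-- `stageProj n k` only depends on the values on `Γ_n`. -/
theorem stageProj_congr (n k : ℕ) (x y : Gam c → ℂ)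
    (h : ∀ δ : Gam c, δ.1.rank ≤ n → δ.1.rank ≤ k → x δ = y δ) :
    ∀ γ, stageProj c n k x γ = stageProj c n k y γ := by
  induction n with
  | zero => intro γ; simp [stageProj]
  | succ n ih =>
    have ih' := ih (fun δ h1 h2 => h δ (by omega) h2)
    intro γ
    rw [stageProj_succ, stageProj_succ, ih' γ]
    have e : stageProj c n k x = stageProj c n k y := funext ih'
    rw [e]
    split_ifs with h1 h2 h3
    · rfl
    · exact h γ (by omega) (by omega)
    · rfl
    · rfl

theorem projFun_congr (k : ℕ) (x y : Gam c → ℂ) (γ : Gam c)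
    (h : ∀ δ : Gam c, δ.1.rank ≤ γ.1.rank → δ.1.rank ≤ k → x δ = y δ) :
    projFun c k x γ = projFun c k y γ :=
  stageProj_congr _ k x y h γ

/-- The defining formula `i_k(x)(γ) = c*_γ(i_k(x))` for `γ ∈ Γ` with `rank γ > k`. -/
theorem projFun_of_lt (k : ℕ) (x : Gam c → ℂ) (γ : Gam c) (h : k < γ.1.rank) :
    projFun c k x γ = extFun c (projFun c) γ (projFun c k x) := by
  obtain ⟨n, hn⟩ : ∃ n, γ.1.rank = n + 1 := ⟨γ.1.rank - 1, by omega⟩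
  have e : projFun c k x γ = stageProj c (n + 1) k x γ := by simp [projFun, hn]
  rw [e, stageProj_succ, if_neg (by omega), if_pos hn, if_neg (by omega)]
  refine extFun_congr _ _ _ _ γ (fun δ hδ => stageProj_eq _ _ _ _ (by omega)) ?_
  intro δ k' hδ
  rw [stageProj_eq _ _ _ _ (by omega)]
  exact projFun_congr _ _ _ _ (fun δ' h1 _ => stageProj_eq _ _ _ _ (by omega))

theorem projFun_projFun_of_le {k n : ℕ} (hkn : k ≤ n) (x : Gam c → ℂ) (γ : Gam c) :
    projFun c n (projFun c k x) γ = projFun c k x γ := by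
  induction hr : γ.1.rank using Nat.strong_induction_on generalizing γ with
  | _ r ih =>
    subst hr
    rcases Nat.lt_or_ge n γ.1.rank with h | h
    · rw [projFun_of_lt n _ γ h, projFun_of_lt k x γ (by omega)]
      refine extFun_congr _ _ _ _ γ (fun δ hδ => ih _ hδ δ rfl) ?_
      intro δ k' hδ
      exact projFun_congr _ _ _ _ (fun δ' h1 _ => ih _ (by omega) δ' rfl)
    · exact projFun_of_le _ _ _ h

theorem projFun_projFun_of_ge {k n : ℕ} (hkn : n ≤ k) (x : Gam c → ℂ) (γ : Gam c) :
    projFun c n (projFun c k x) γ = projFun c n x γ :=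
  projFun_congr _ _ _ _ (fun δ _ h => projFun_of_le _ _ _ (by omega))

theorem eight_le_m (p : Params K) : ∀ j, 1 ≤ j → 8 ≤ p.m j := by
  intro j hj
  induction j, hj using Nat.le_induction with
  | base => exact p.m_one
  | succ j hj ih => have := p.m_succ j hj; nlinarith

theorem norm_le_one_of_mem_disc {n : ℕ} {z : ℂ} (h : z ∈ disc n) : ‖z‖ ≤ 1 := by
  obtain ⟨k₁, k₂, -, h1, -, -, rfl⟩ := h
  have e : ((k₂ : ℂ) / 2 ^ n) * (2 * Real.pi) * Complex.I =
      (((k₂ : ℝ) / 2 ^ n * (2 * Real.pi) : ℝ) : ℂ) * Complex.I := by push_cast; ring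
  rw [norm_mul, e, Complex.norm_exp_ofReal_mul_I, mul_one, norm_div, norm_pow]
  simp only [Complex.norm_natCast, Complex.norm_ofNat]
  rw [div_le_one (by positivity)]
  exact_mod_cast h1

theorem norm_coeff_le {n j : ℕ} {l : ℂ} (hl : l ∈ disc n) (hj : 1 ≤ j) :
    ‖(p.m j : ℂ)⁻¹ * l‖ ≤ 1 / 8 := by
  rw [norm_mul, norm_inv, Complex.norm_natCast]
  have h1 : (8 : ℝ) ≤ p.m j := by exact_mod_cast eight_le_m p j hj
  have h2 : (p.m j : ℝ)⁻¹ ≤ 1 / 8 := by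
    rw [one_div]; exact inv_anti₀ (by norm_num) h1
  have h3 := norm_le_one_of_mem_disc hl
  have h4 : (0 : ℝ) ≤ (p.m j : ℝ)⁻¹ := by positivity
  nlinarith [norm_nonneg l]

/-- The extension operators are uniformly bounded. -/
theorem norm_projFun_le (x : Gam c → ℂ) (M : ℝ) (hx : ∀ γ, ‖x γ‖ ≤ M) (k : ℕ) (γ : Gam c) :
    ‖projFun c k x γ‖ ≤ 2 * M := by
  have hM : 0 ≤ M := (norm_nonneg _).trans (hx γ)
  induction hr : γ.1.rank using Nat.strong_induction_on generalizing γ k with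
  | _ r ih =>
    subst hr
    rcases Nat.lt_or_ge k γ.1.rank with h | h
    swap
    · rw [projFun_of_le _ _ _ h]; linarith [hx γ]
    rw [projFun_of_lt k x γ h]
    have key : ∀ δ : Gam c, δ.1.rank < γ.1.rank → ∀ b, ‖projFun c b (projFun c k x) δ‖ ≤ 2 * M := by
      intro δ hδ b
      rcases le_total k b with hb | hb
      · rw [projFun_projFun_of_le hb]; exact ih _ hδ _ δ rfl
      · rw [projFun_projFun_of_ge hb]; exact ih _ hδ _ δ rfl
    have diff : ∀ (q : ℂ), ‖q‖ ≤ 1 / 8 → ∀ δ : Gam c, δ.1.rank < γ.1.rank → ∀ b b' : ℕ,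
        ‖q * (projFun c b (projFun c k x) δ - projFun c b' (projFun c k x) δ)‖ ≤ M := by
      intro q hq δ hδ b b'
      have e1 := norm_sub_le (projFun c b (projFun c k x) δ) (projFun c b' (projFun c k x) δ)
      have e2 := key δ hδ b
      have e3 := key δ hδ b'
      rw [norm_mul]
      nlinarith [norm_nonneg q, norm_nonneg
        (projFun c b (projFun c k x) δ - projFun c b' (projFun c k x) δ)]
    match γ, h, ih, diff with
    | ⟨.base _ _, _⟩, _, _, _ => simp only [extFun, LinearMap.zero_apply, norm_zero]; linarith
    | ⟨.age1 n a b η l j κ, h'⟩, _, _, diff =>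
      have h3 : η.rank < n := h'.1.2.2.1
      have := diff _ (norm_coeff_le (p := p) h'.1.2.2.2.1 h'.1.2.2.2.2.1) ⟨η, h'.2.1⟩ h3 b (a - 1)
      simp only [extFun, LinearMap.smul_apply, LinearMap.comp_apply, LinearMap.sub_apply,
        LinearMap.proj_apply, Pi.sub_apply, smul_eq_mul]
      linarith
    | ⟨.succ n ξ a b η l j κ, h'⟩, _, ih, diff =>
      have h3 : η.rank < n := h'.1.2.2.2.2.2.2.1
      have h4 : ξ.rank < n := by have := h'.1.2.1; omega
      have h5 : ξ.rank < a := h'.1.2.2.2.2.1.1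
      have h6 : a ≤ b := h'.1.2.2.2.2.1.2.1
      have h7 := diff _ (norm_coeff_le (p := p) h'.1.2.2.2.2.2.2.2.1 h'.1.2.2.2.2.2.2.2.2.1)
        ⟨η, h'.2.2.1⟩ h3 b (a - 1)
      simp only [extFun, LinearMap.smul_apply, LinearMap.comp_apply, LinearMap.sub_apply,
        LinearMap.proj_apply, Pi.sub_apply, smul_eq_mul, LinearMap.add_apply]
      rcases Nat.lt_or_ge k ξ.rank with h8 | h8
      · rw [projFun_projFun_of_le (by omega), projFun_projFun_of_le (by omega), sub_self,
          mul_zero, add_zero]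
        exact ih _ h4 k ⟨ξ, h'.2.1⟩ rfl
      · rw [projFun_of_le k x ⟨ξ, h'.2.1⟩ h8]
        refine (norm_add_le _ _).trans ?_
        linarith [hx ⟨ξ, h'.2.1⟩]

variable (c)

/-- The Banach space `ℓ_∞(Γ)`. -/
abbrev LInf : Type u := lp (fun _ : Gam c => ℂ) ∞

/-- The projection `P_{[1,k]} = i_k ∘ r_k` as a bounded operator on `ℓ_∞(Γ)`. -/
def proj (k : ℕ) : LInf c →L[ℂ] LInf c :=
  LinearMap.mkContinuous
    { toFun := fun x => ⟨projFun c k x, memℓp_infty ⟨2 * ‖x‖, by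
        rintro _ ⟨γ, rfl⟩
        exact norm_projFun_le _ _ (fun γ => lp.norm_apply_le_norm (by simp) x γ) k γ⟩⟩
      map_add' := fun x y => by
        ext γ
        exact congrFun (map_add (projFun c k) (x : Gam c → ℂ) (y : Gam c → ℂ)) γ
      map_smul' := fun a x => by
        ext γ; simp }
    2 (fun x => lp.norm_le_of_forall_le (by positivity) fun γ =>
        norm_projFun_le _ _ (fun γ => lp.norm_apply_le_norm (by simp) x γ) k γ)

/-- The space `𝔛_{C(K)}`: the closure in `ℓ_∞(Γ)` of the union of the increasing sequence of
subspaces `Y_n = i_n(ℓ_∞(Γ_n))`. -/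
def spaceX : Submodule ℂ (LInf c) :=
  (⨆ n : ℕ, LinearMap.range (proj c n : LInf c →ₗ[ℂ] LInf c)).topologicalClosure

/-- The Banach space `𝔛_{C(K)}` with its usual norm. -/
abbrev X : Type u := spaceX c

instance : CompleteSpace (X c) :=
  (Submodule.isClosed_topologicalClosure _).completeSpace_coe

open Classical in
/-- The Schauder basis vector `d_γ = i_{rank γ}(e_γ)`. -/
def basisVec (γ : Gam c) : X c :=
  ⟨proj c γ.1.rank (lp.single ∞ γ (1 : ℂ)),
    Submodule.le_topologicalClosure _
      (Submodule.mem_iSup_of_mem γ.1.rank ⟨_, rfl⟩)⟩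

/-- `T` is the bounded extension of the diagonal operator `φ̂ : d_γ ↦ φ(κ(γ)) d_γ`. -/
def IsHat (φ : C(K, ℂ)) (T : X c →L[ℂ] X c) : Prop :=
  ∀ γ : Gam c, T (basisVec c γ) = φ γ.1.kappa • basisVec c γ

/-- The functions that are Lipschitz with respect to the metric `ϱ`. -/
def IsLip (p : Params K) (φ : C(K, ℂ)) : Prop :=
  ∃ L : ℝ, ∀ x y : K, ‖φ x - φ y‖ ≤ L * rho p.enum x y

end Space

/-! ### Calkin algebras and equivalent norms -/

section Calkin

variable (E : Type u) [NormedAddCommGroup E] [NormedSpace ℂ E]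

/-- The ideal of compact operators in the algebra of bounded operators. -/
def compactIdeal : Ideal (E →L[ℂ] E) where
  carrier := {T | IsCompactOperator T}
  add_mem' := fun ha hb => IsCompactOperator.add ha hb
  zero_mem' := isCompactOperator_zero
  smul_mem' := fun S _ hT => IsCompactOperator.clm_comp hT S

instance : (compactIdeal E).IsTwoSided :=
  ⟨fun S hT => IsCompactOperator.comp_clm hT S⟩

/-- The Calkin algebra `𝓛(E)/𝓚(E)`, with the quotient algebra structure and the quotient norm. -/
abbrev Calkin : Type u := (E →L[ℂ] E) ⧸ compactIdeal E

theorem isClosed_compactIdeal [CompleteSpace E] :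
    IsClosed (compactIdeal E : Set (E →L[ℂ] E)) :=
  isClosed_setOfPred_isCompactOperator

instance [CompleteSpace E] : NormedAddCommGroup (Calkin E) :=
  Submodule.Quotient.normedAddCommGroup (hS := isClosed_compactIdeal E) (compactIdeal E)

/-- An equivalent norm on `E`. -/
structure EquivalentNorm extends Seminorm ℂ E where
  lower : ∃ C : ℝ, 0 < C ∧ ∀ x, C * ‖x‖ ≤ toFun x
  upper : ∃ C : ℝ, ∀ x, toFun x ≤ C * ‖x‖

variable {E}

/-- The space `E` endowed with the equivalent norm `ν`. -/
def Renormed (_ν : EquivalentNorm E) : Type u := E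

namespace Renormed

variable (ν : EquivalentNorm E)

instance : AddCommGroup (Renormed ν) := inferInstanceAs (AddCommGroup E)

instance : Module ℂ (Renormed ν) := inferInstanceAs (Module ℂ E)

instance : NormedAddCommGroup (Renormed ν) :=
  AddGroupNorm.toNormedAddCommGroup (E := Renormed ν)
    { toFun := fun x => ν.toSeminorm x
      map_zero' := map_zero ν.toSeminorm
      add_le' := map_add_le_add ν.toSeminorm
      neg' := map_neg_eq_map ν.toSeminorm
      eq_zero_of_map_eq_zero' := fun x hx => by
        obtain ⟨C, hC, h⟩ := ν.lower
        have h1 : C * ‖(show E from x)‖ ≤ 0 := (h x).trans hx.le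
        have h2 : ‖(show E from x)‖ = 0 := by nlinarith [norm_nonneg (show E from x)]
        exact norm_eq_zero.mp h2 }

instance : NormedSpace ℂ (Renormed ν) where
  norm_smul_le := fun a x => (map_smul_eq_mul ν.toSeminorm a x).le

end Renormed

/-- The identity map from `E` with its own norm to `E` with the norm `ν`. -/
def toRenormed (ν : EquivalentNorm E) : E ≃L[ℂ] Renormed ν :=
  LinearEquiv.toContinuousLinearEquivOfBounds
    (LinearEquiv.refl ℂ E : E ≃ₗ[ℂ] Renormed ν)
    ν.upper.choose (Classical.choose ν.lower)⁻¹
    (fun x => ν.upper.choose_spec x)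
    (fun x => by
      have h := Classical.choose_spec ν.lower
      have h2 := h.2 x
      rw [inv_mul_eq_div, le_div_iff₀ h.1, mul_comm]
      exact h2)

instance [CompleteSpace E] (ν : EquivalentNorm E) : CompleteSpace (Renormed ν) :=
  (completeSpace_congr (e := (toRenormed ν).toEquiv) (toRenormed ν).isUniformEmbedding).mp
    inferInstance

/-- The class `[T]` of `T ∈ 𝓛(E)` in the Calkin algebra of `(E, ν)`. -/
def calkinClass (ν : EquivalentNorm E) (T : E →L[ℂ] E) : Calkin (Renormed ν) :=
  Ideal.Quotient.mk (compactIdeal (Renormed ν)) ((toRenormed ν).conjContinuousAlgEquiv T)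

end Calkin

/-- `Ψ : C(K) → Cal(𝔛_{C(K)}, ν)` is the continuous extension to `C(K)` of the map `φ ↦ [φ̂]`
on the `ϱ`-Lipschitz functions; in particular `φ̂` is bounded for these. -/
def IsPsi {p : Params K} (c : Coding p) (ν : EquivalentNorm (X c))
    (Ψ : C(K, ℂ) → Calkin (Renormed ν)) : Prop :=
  Continuous Ψ ∧ ∀ φ : C(K, ℂ), IsLip p φ → ∃ T : X c →L[ℂ] X c, IsHat c φ T ∧
    Ψ φ = calkinClass ν T

/-- `ν(x) = sup ({‖x‖} ∪ {‖P_{[N(n),∞)} φ̂ x‖ : n ≥ 1, φ ∈ 𝓑_n})` for all `x`, where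
`P_{[N,∞)} = id - P_{[1,N-1]}`; in particular `φ̂` is bounded for `φ ∈ 𝓑_n`. -/
def IsTailNorm {p : Params K} (c : Coding p) (N : ℕ → ℕ) (ν : EquivalentNorm (X c)) : Prop :=
  (∀ n, 1 ≤ n → ∀ φ ∈ semigroupB p.enum n, ∃ T : X c →L[ℂ] X c, IsHat c φ T) ∧
  ∀ x : X c, IsLUB ({‖x‖} ∪ {r : ℝ | ∃ n, 1 ≤ n ∧ ∃ φ ∈ semigroupB p.enum n,
    ∃ T : X c →L[ℂ] X c, IsHat c φ T ∧
      r = ‖((T x : X c) : LInf c) - proj c (N n - 1) ((T x : X c) : LInf c)‖}) (ν.toSeminorm x)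

end CKCalkin

end

open scoped ENNReal

noncomputable section

namespace CKCalkin

universe u

variable {K : Type u} [MetricSpace K] [CompactSpace K] {p : Params K} {c : Coding p}

/-! Since `x(γ) - c*_γ(x)` is the coordinate of `x` at `d_γ`, the operator `φ̂` satisfies `(φ̂x)(γ)
= φ(κ(γ)) (x(γ) - c*_γ(x)) + c*_γ(φ̂x)`. This recursion on the rank defines it on all functions on
`Γ` (`hatFun`), where it commutes with every `P_{[1,k]}`.

The analytic core is `norm_hatFun_sub_le`: if `y` vanishes below rank `a`, then `(φ̂y)(γ)` differs
from `φ(κ(γ)) y(γ)` by at most a constant times `weight(I, γ) (‖φ‖ + L 2^{-a}) R`, where `min I =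
a`, `L` is a `ϱ`-Lipschitz constant of `φ` and `R` bounds all `P_J y`. The constraints defining `Γ`
serve exactly this: passing from `ξ` to its successor moves `κ` by at most `m_j⁻¹ 2^{-rank ξ}`, and
the new `η` has nearby `κ` and small weight, so the errors along a node sum like a geometric series.
Applied to `y = x - P_{[1,n]} x` it gives `‖P_{(n,∞)} φ̂‖ ≤ 19 (‖φ‖ + L 2^{-(n+1)})`.

Functions in `𝓑_n` are `2^n`-Lipschitz and bounded by 1, so the operators `P_{(n,∞)} φ̂`, `φ ∈ 𝓑_n`,
are uniformly bounded and their supremum is an equivalent norm. The sets `𝓑_n` increase and are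
closed under products, so the product of two such operators is a third; hence each is a contraction
for the new norm (`tailSeminorm_tailHat_le`). Removing the finite-rank part `P_{[1,n]} φ̂` does not
change the class, so `‖[φ̂]‖ ≤ 1` on `𝓑_n`. Letting `θ → 1` and rescaling by rationals gives `‖[φ̂]‖
≤ ‖φ‖` on `𝒜`. Conversely, for `κ ∈ K_n` the vectors `d_{(m,κ)}`, `m ≥ n`, are separated
eigenvectors for `φ(κ)`, which forces `|φ(κ)| ≤ ‖[φ̂]‖`; the nets are `ϱ`-dense, so equality holds
on `𝒜`.

Letting `n → ∞` in the bound with 19 shows that `φ ↦ [φ̂]` is bounded in the sup norm on the algebra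
of Lipschitz functions. That algebra contains `𝒜`, hence is dense, and the homomorphism extends; the
isometry passes to the limit. -/

theorem rank_induction {motive : Gam c → Prop}
    (step : ∀ γ : Gam c, (∀ δ : Gam c, δ.1.rank < γ.1.rank → motive δ) → motive γ)
    (γ : Gam c) : motive γ :=
  (measure fun γ : Gam c => γ.1.rank).wf.induction γ step

theorem extFun_projFun_congr {x y : Gam c → ℂ} {γ : Gam c}
    (h : ∀ δ : Gam c, δ.1.rank < γ.1.rank → x δ = y δ) :
    extFun c (projFun c) γ x = extFun c (projFun c) γ y :=
  extFun_congr _ _ x y γ h fun _ _ hδ =>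
    projFun_congr _ _ _ _ fun δ' h1 _ => h δ' (h1.trans_lt hδ)

theorem projFun_projFun (k n : ℕ) (x : Gam c → ℂ) :
    projFun c n (projFun c k x) = projFun c (min n k) x := by
  ext γ
  rcases le_total k n with h | h
  · rw [min_eq_right h, projFun_projFun_of_le h]
  · rw [min_eq_left h, projFun_projFun_of_ge h]

theorem projFun_zero (x : Gam c → ℂ) : projFun c 0 x = 0 := by
  ext γ
  rw [projFun_congr 0 x 0 γ fun δ _ h => by have := one_le_rank δ; omega, map_zero]

/-! ### The diagonal operators on functions on `Γ` -/

/-- The diagonal operator `d_γ ↦ φ(κ(γ)) d_γ`, extended to all functions on `Γ`. -/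
def hatFun (φ : K → ℂ) (x : Gam c → ℂ) (γ : Gam c) : ℂ :=
  φ γ.1.kappa * (x γ - extFun c (projFun c) γ x) +
    -- The truncation makes the recursion well founded; it is harmless because `c*_γ` only sees
    -- lower ranks.
    extFun c (projFun c) γ fun δ => if δ.1.rank < γ.1.rank then hatFun φ x δ else 0
termination_by γ.1.rank

theorem hatFun_eq (φ : K → ℂ) (x : Gam c → ℂ) (γ : Gam c) :
    hatFun φ x γ = φ γ.1.kappa * (x γ - extFun c (projFun c) γ x) +
      extFun c (projFun c) γ (hatFun φ x) := by
  rw [hatFun]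
  congr 1
  exact extFun_projFun_congr fun δ hδ => if_pos hδ

theorem hatFun_congr (φ : K → ℂ) (x y : Gam c → ℂ) (γ : Gam c)
    (h : ∀ δ : Gam c, δ.1.rank ≤ γ.1.rank → x δ = y δ) : hatFun φ x γ = hatFun φ y γ := by
  induction γ using rank_induction with
  | step γ ih =>
    rw [hatFun_eq, hatFun_eq, h γ le_rfl, extFun_projFun_congr fun δ hδ => h δ hδ.le,
      extFun_projFun_congr fun δ hδ => ih δ hδ fun δ' h' => h δ' (h'.trans hδ.le)]

theorem hatFun_add (φ : K → ℂ) (x y : Gam c → ℂ) :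
    hatFun φ (x + y) = hatFun φ x + hatFun φ y := by
  ext γ
  induction γ using rank_induction with
  | step γ ih =>
    rw [Pi.add_apply, hatFun_eq, hatFun_eq φ x, hatFun_eq φ y, extFun_projFun_congr ih]
    simp only [map_add, Pi.add_apply]
    ring

theorem hatFun_smul (φ : K → ℂ) (a : ℂ) (x : Gam c → ℂ) :
    hatFun φ (a • x) = a • hatFun φ x := by
  ext γ
  induction γ using rank_induction with
  | step γ ih =>
    rw [Pi.smul_apply, hatFun_eq, hatFun_eq φ x, extFun_projFun_congr ih]
    simp only [map_smul, Pi.smul_apply, smul_eq_mul]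
    ring

theorem hatFun_zero (φ : K → ℂ) : hatFun φ (0 : Gam c → ℂ) = 0 := by
  simpa using hatFun_smul φ 0 (0 : Gam c → ℂ)

theorem hatFun_sub (φ : K → ℂ) (x y : Gam c → ℂ) :
    hatFun φ (x - y) = hatFun φ x - hatFun φ y := by
  have h := hatFun_smul φ (-1) y
  rw [neg_one_smul, neg_one_smul] at h
  rw [sub_eq_add_neg, hatFun_add, h, ← sub_eq_add_neg]

theorem hatFun_eq_zero {φ : K → ℂ} {x : Gam c → ℂ} {γ : Gam c}
    (h : ∀ δ : Gam c, δ.1.rank ≤ γ.1.rank → x δ = 0) : hatFun φ x γ = 0 := by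
  rw [hatFun_congr φ x 0 γ h, hatFun_zero, Pi.zero_apply]

/-- Above rank `k` the vector `P_{[1,k]} x` has no coordinates, so both sides obey the same
recursion `z(γ) = c*_γ(z)`; up to rank `k` only the values of `x` there matter. -/
theorem hatFun_projFun (φ : K → ℂ) (k : ℕ) (x : Gam c → ℂ) :
    hatFun φ (projFun c k x) = projFun c k (hatFun φ x) := by
  ext γ
  induction γ using rank_induction with
  | step γ ih =>
    rcases Nat.lt_or_ge k γ.1.rank with h | h
    · rw [hatFun_eq, projFun_of_lt k x γ h, sub_self, mul_zero, zero_add,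
        extFun_projFun_congr ih, ← projFun_of_lt k _ γ h]
    · rw [projFun_of_le k _ γ h]
      exact hatFun_congr _ _ _ _ fun δ hδ => projFun_of_le _ _ _ (hδ.trans h)

/-- `hatFun φ` acts as multiplication by `φ ∘ κ` on the lowest level of the support. -/
theorem hatFun_apply_of_forall_lt {φ : K → ℂ} {x : Gam c → ℂ} {γ : Gam c}
    (h : ∀ δ : Gam c, δ.1.rank < γ.1.rank → x δ = 0) :
    hatFun φ x γ = φ γ.1.kappa * x γ := by
  have h0 : extFun c (projFun c) γ x = 0 := by
    rw [extFun_projFun_congr (y := 0) h, map_zero]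
  have h1 : extFun c (projFun c) γ (hatFun φ x) = 0 := by
    rw [extFun_projFun_congr (y := 0) fun δ hδ =>
      hatFun_eq_zero fun δ' h' => h δ' (h'.trans_lt hδ), map_zero]
  rw [hatFun_eq, h0, h1, sub_zero, add_zero]

/-! ### Bounds that are stable under interval projections -/

/-- All the vectors `P_I y`, for intervals `I`, are bounded by `R`. -/
def IntervalBounded (R : ℝ) (y : Gam c → ℂ) : Prop :=
  ∀ k l γ, ‖projFun c k y γ - projFun c l y γ‖ ≤ R

theorem IntervalBounded.nonneg {R : ℝ} {y : Gam c → ℂ} (h : IntervalBounded R y) (γ : Gam c) :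
    0 ≤ R := (norm_nonneg _).trans (h 0 0 γ)

theorem IntervalBounded.norm_apply_le {R : ℝ} {y : Gam c → ℂ} (h : IntervalBounded R y)
    (γ : Gam c) : ‖y γ‖ ≤ R := by
  simpa [projFun_zero, projFun_of_le] using h γ.1.rank 0 γ

theorem IntervalBounded.symm_of_le {R : ℝ} {y : Gam c → ℂ}
    (h : ∀ k l γ, l ≤ k → ‖projFun c k y γ - projFun c l y γ‖ ≤ R) : IntervalBounded R y := by
  intro k l γ
  rcases le_total l k with h' | h'
  · exact h k l γ h'
  · rw [norm_sub_rev]; exact h l k γ h'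

/-- An interval projection of an interval projection is again one, so the constant `R` is not
worsened. This lets the induction in `norm_hatFun_sub_le` pass from `y` to `P_I y`. -/
theorem IntervalBounded.sub {R : ℝ} {y : Gam c → ℂ} (h : IntervalBounded R y) {a b : ℕ}
    (hab : a ≤ b) : IntervalBounded R (projFun c b y - projFun c a y) := by
  refine symm_of_le fun k l γ hlk => ?_
  simp only [map_sub, projFun_projFun, Pi.sub_apply]
  rcases le_total k a with h1 | h1
  · rw [min_eq_left h1, min_eq_left (h1.trans hab), min_eq_left (hlk.trans h1),
      min_eq_left (hlk.trans (h1.trans hab))]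
    simpa using h.nonneg γ
  rw [min_eq_right h1]
  rcases le_total l a with h2 | h2
  · rw [min_eq_left h2, min_eq_left (h2.trans hab), sub_self, sub_zero]
    exact h _ _ γ
  · rw [min_eq_right h2, sub_sub_sub_cancel_right]
    exact h _ _ γ

theorem intervalBounded_sub_projFun {R : ℝ} {x : Gam c → ℂ} (h : ∀ γ, ‖x γ‖ ≤ R) (a : ℕ) :
    IntervalBounded (4 * R) (x - projFun c a x) := by
  have h0 : IntervalBounded (4 * R) x := fun k l γ =>
    (norm_sub_le _ _).trans (by linarith [norm_projFun_le x R h k γ, norm_projFun_le x R h l γ])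
  refine .symm_of_le fun k l γ hlk => ?_
  simp only [map_sub, projFun_projFun, Pi.sub_apply]
  rcases le_total k a with h1 | h1
  · rw [min_eq_left h1, min_eq_left (hlk.trans h1)]
    simpa using h0.nonneg γ
  rw [min_eq_right h1]
  rcases le_total l a with h2 | h2
  · rw [min_eq_left h2, sub_self, sub_zero]
    exact h0 _ _ γ
  · rw [min_eq_right h2, sub_sub_sub_cancel_right]
    exact h0 _ _ γ

/-! ### Weights and the arithmetic of the error terms -/

theorem weight_nonneg (γ : Node K) : 0 ≤ p.weight γ := by
  cases γ <;> simp [Params.weight]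

theorem intervalWeight_nonneg (a : ℕ) (γ : Node K) : 0 ≤ p.intervalWeight a γ := by
  unfold Params.intervalWeight
  split_ifs
  exacts [le_rfl, weight_nonneg γ]

theorem intervalWeight_le_weight (a : ℕ) (γ : Node K) : p.intervalWeight a γ ≤ p.weight γ := by
  unfold Params.intervalWeight
  split_ifs
  exacts [weight_nonneg γ, le_rfl]

theorem inv_m_le {j : ℕ} (hj : 1 ≤ j) : (p.m j : ℝ)⁻¹ ≤ 1 / 8 := by
  rw [one_div]
  exact inv_anti₀ (by norm_num) (by exact_mod_cast eight_le_m p j hj)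

theorem weight_le (γ : Gam c) : p.weight γ.1 ≤ 1 / 8 := by
  match γ with
  | ⟨.base _ _, _⟩ => simp [Params.weight]
  | ⟨.age1 _ _ _ _ _ _ _, h⟩ => exact inv_m_le h.1.2.2.2.2.1
  | ⟨.succ _ _ _ _ _ _ _ _, h⟩ => exact inv_m_le h.1.2.2.2.2.2.2.2.2.1

theorem norm_coeff_le_inv {n j : ℕ} {l : ℂ} (hl : l ∈ disc n) :
    ‖(p.m j : ℂ)⁻¹ * l‖ ≤ (p.m j : ℝ)⁻¹ := by
  rw [norm_mul, norm_inv, Complex.norm_natCast]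
  exact mul_le_of_le_one_right (by positivity) (norm_le_one_of_mem_disc hl)

theorem IsNode.isBarNode {γ : Node K} (h : IsNode c γ) : p.IsBarNode γ := by
  match γ with
  | .base _ _ => exact h
  | .age1 _ _ _ _ _ _ _ => exact h.1
  | .succ _ _ _ _ _ _ _ _ => exact h.1

theorem norm_coeff_mul_sub_le {q u v s t : ℂ} {w D d R : ℝ} (hq : ‖q‖ ≤ w) (hD : ‖u - s * v‖ ≤ D)
    (hd : ‖s - t‖ ≤ d) (hv : ‖v‖ ≤ R) : ‖q * (u - t * v)‖ ≤ w * (D + d * R) := by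
  have e : u - t * v = (u - s * v) + (s - t) * v := by ring
  have h : ‖u - t * v‖ ≤ D + d * R := by
    rw [e]
    refine (norm_add_le _ _).trans (add_le_add hD ?_)
    rw [norm_mul]
    exact mul_le_mul hd hv (norm_nonneg _) ((norm_nonneg _).trans hd)
  rw [norm_mul]
  exact mul_le_mul hq h (norm_nonneg _) ((norm_nonneg _).trans hq)

/-- The inner error is at most `(1/8) · 30 = 3.75` and replacing `κ(η)` by `κ` costs `2M`; together
`5.75 ≤ 6`. -/
theorem age_one_term_bound {w M B R d : ℝ} (hw : 0 ≤ w) (hR : 0 ≤ R) (hMB : M ≤ B) (hB : 0 ≤ B)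
    (hd : 0 ≤ d) : w * (1 / 8 * 30 * B * R + (M + M) * R) ≤ w * (6 + 24 * d) * B * R := by
  have h : 1 / 8 * 30 * B * R + (M + M) * R ≤ (6 + 24 * d) * (B * R) := by
    have := mul_le_mul_of_nonneg_right hMB hR
    have := mul_nonneg hd (mul_nonneg hB hR)
    have := mul_nonneg hB hR
    linarith
  calc _ ≤ w * ((6 + 24 * d) * (B * R)) := mul_le_mul_of_nonneg_left h hw
    _ = _ := by ring

/-- Here `t = 2^a / 2^{rank ξ}`, `t' = 2^a / 2^n` and `s = 2^{-rank ξ}`. In units of `w t B R` the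
two displacements of `κ` cost 1 each and the error at `η` costs `30 / 2 = 15`. The total 17 is
covered by the growth `24 (t - t') ≥ 18 t` of the bound. -/
theorem succ_term_bound {w B R L B' A t t' s : ℝ} (hw : 0 ≤ w) (hR : 0 ≤ R) (hB : 0 ≤ B)
    (hB' : B' ≤ B) (hB'0 : 0 ≤ B') (hA : A ≤ 30) (hs : 0 ≤ s) (hLs : L * s ≤ B * t)
    (hst : s ≤ t / 2) (htt : t' ≤ t / 4) {W : ℝ} (hW0 : 0 ≤ W) (hW : W ≤ s) :
    w * (6 + 24 * (1 - t)) * B * R + L * (w * s) * R + w * (W * A * B' * R + L * s * R) ≤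
      w * (6 + 24 * (1 - t')) * B * R := by
  have h1 : W * A * B' ≤ t / 2 * 30 * B := by
    have hWt : W ≤ t / 2 := hW.trans hst
    have ht : 0 ≤ t / 2 := hs.trans hst
    calc W * A * B' ≤ W * 30 * B' := by gcongr
      _ ≤ t / 2 * 30 * B := by gcongr
  have h2 : W * A * B' * R ≤ t / 2 * 30 * B * R := mul_le_mul_of_nonneg_right h1 hR
  have h3 : L * s * R ≤ B * t * R := mul_le_mul_of_nonneg_right hLs hR
  have h4 : t' * (B * R) ≤ t / 4 * (B * R) := mul_le_mul_of_nonneg_right htt (mul_nonneg hB hR)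
  have h5 : 0 ≤ t * (B * R) := mul_nonneg (by linarith) (mul_nonneg hB hR)
  have h : (6 + 24 * (1 - t)) * B * R + L * s * R + (W * A * B' * R + L * s * R) ≤
      (6 + 24 * (1 - t')) * B * R := by linarith
  calc _ = w * ((6 + 24 * (1 - t)) * B * R + L * s * R + (W * A * B' * R + L * s * R)) := by ring
    _ ≤ w * ((6 + 24 * (1 - t')) * B * R) := mul_le_mul_of_nonneg_left h hw
    _ = _ := by ring

theorem two_pow_div_two_pow_le_one {a n : ℕ} (h : a ≤ n) : (2 : ℝ) ^ a / 2 ^ n ≤ 1 :=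
  (div_le_one (by positivity)).mpr (pow_le_pow_right₀ (by norm_num) h)

/-! ### The almost-commutation estimate -/

section Estimate

variable {φ : K → ℂ} {M L : ℝ}

/-- With no control of the distance from `κ(η)` to `κ`, the crude bound `2M` is used; it is
affordable only because such a term occurs once, at the first node meeting the support of `y`. -/
theorem norm_age_one_term_le (hM : ∀ κ, ‖φ κ‖ ≤ M) (hL0 : 0 ≤ L) {η : Gam c} {a n j : ℕ}
    {R : ℝ} {y : Gam c → ℂ} (hy : IntervalBounded R y)
    (ih : ‖hatFun φ y η - φ η.1.kappa * y η‖ ≤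
      p.intervalWeight a η.1 * (6 + 24 * (1 - 2 ^ a / 2 ^ η.1.rank)) * (M + L / 2 ^ a) * R)
    {l : ℂ} (hl : l ∈ disc n) (κ : K) {r : ℕ} (hr : a ≤ r) :
    ‖((p.m j : ℂ)⁻¹ * l) * (hatFun φ y η - φ κ * y η)‖ ≤
      (p.m j : ℝ)⁻¹ * (6 + 24 * (1 - 2 ^ a / 2 ^ r)) * (M + L / 2 ^ a) * R := by
  have hM0 : 0 ≤ M := (norm_nonneg _).trans (hM κ)
  have hR := hy.nonneg η
  have hB : 0 ≤ M + L / 2 ^ a := by positivity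
  refine (norm_coeff_mul_sub_le (norm_coeff_le_inv hl) (ih.trans ?_)
    ((norm_sub_le _ _).trans (add_le_add (hM _) (hM _))) (hy.norm_apply_le η)).trans
    (age_one_term_bound (by positivity) hR (le_add_of_nonneg_right (by positivity)) hB
      (sub_nonneg.mpr (two_pow_div_two_pow_le_one hr)))
  have h1 : (6 + 24 * (1 - 2 ^ a / 2 ^ η.1.rank) : ℝ) ≤ 30 := by
    have : (0 : ℝ) ≤ 2 ^ a / 2 ^ η.1.rank := by positivity
    linarith
  have h2 := intervalWeight_nonneg (p := p) a η.1
  have h3 := (intervalWeight_le_weight (p := p) a η.1).trans (weight_le η)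
  have h4 : p.intervalWeight a η.1 * (6 + 24 * (1 - 2 ^ a / 2 ^ η.1.rank)) ≤ 1 / 8 * 30 :=
    (mul_le_mul_of_nonneg_left h1 h2).trans (mul_le_mul_of_nonneg_right h3 (by norm_num))
  gcongr

/-- `φ̂` almost commutes with the evaluation functionals. -/
theorem norm_hatFun_sub_le (hM : ∀ κ, ‖φ κ‖ ≤ M) (hL0 : 0 ≤ L)
    (hL : ∀ x y, ‖φ x - φ y‖ ≤ L * rho p.enum x y) (γ : Gam c) {a : ℕ} (ha : 1 ≤ a) {R : ℝ}
    {y : Gam c → ℂ} (hy : IntervalBounded R y) (h0 : ∀ δ : Gam c, δ.1.rank < a → y δ = 0) :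
    ‖hatFun φ y γ - φ γ.1.kappa * y γ‖ ≤
      p.intervalWeight a γ.1 * (6 + 24 * (1 - 2 ^ a / 2 ^ γ.1.rank)) * (M + L / 2 ^ a) * R := by
  induction γ using rank_induction generalizing a y with
  | step γ ih =>
    rcases Nat.lt_or_ge a γ.1.rank with har | har
    swap
    -- At the lowest level of the support `φ̂` is exact multiplication, which is why the interval
    -- weight 0 is correct there.
    · rw [hatFun_apply_of_forall_lt fun δ hδ => h0 δ (hδ.trans_le har), sub_self, norm_zero,
        Params.intervalWeight, if_pos har]
      simp
    have hM0 : 0 ≤ M := (norm_nonneg _).trans (hM γ.1.kappa)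
    have hR := hy.nonneg γ
    have vanish : ∀ δ : Gam c, δ.1.rank < a → ∀ k l : ℕ,
        (projFun c k y - projFun c l y) δ = 0 := fun δ hδ k l => by
      have e : ∀ k, projFun c k y δ = 0 := fun k => by
        rw [projFun_congr k y 0 δ fun δ' h1 _ => h0 δ' (h1.trans_lt hδ), map_zero]; rfl
      rw [Pi.sub_apply, e, e, sub_self]
    have key : hatFun φ y γ - φ γ.1.kappa * y γ = extFun c (projFun c) γ (hatFun φ y) -
        φ γ.1.kappa * extFun c (projFun c) γ y := by
      rw [hatFun_eq]; ring
    rw [key, Params.intervalWeight, if_neg (by omega)]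
    clear key
    match γ, har, ih with
    | ⟨.base _ _, _⟩, _, _ => simp [extFun, Params.weight]
    | ⟨.age1 n a' b η l j κ, h⟩, har, ih =>
      have h1 : η.rank < n := h.1.2.2.1
      have h2 : a' - 1 ≤ b := by have := h.1.1.2.1; omega
      have e := norm_age_one_term_le (j := j) hM hL0 (hy.sub h2)
        (ih ⟨η, h.2.1⟩ h1 ha (hy.sub h2) fun δ hδ => vanish δ hδ b (a' - 1))
        h.1.2.2.2.1 κ har.le
      rw [hatFun_sub, hatFun_projFun, hatFun_projFun] at e
      refine le_of_eq_of_le (congrArg _ ?_) e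
      simp only [extFun, LinearMap.smul_apply, LinearMap.comp_apply, LinearMap.sub_apply,
        LinearMap.proj_apply, Pi.sub_apply, smul_eq_mul, Node.kappa]
      ring
    | ⟨.succ n ξ a' b η l j κ, h⟩, har, ih =>
      have h1 : η.rank < n := h.1.2.2.2.2.2.2.1
      have h2 : a' - 1 ≤ b := by have := h.1.2.2.2.2.1.2.1; omega
      have h3 : ξ.rank + 1 < n := h.1.2.1
      have h4 : ξ.rank < a' := h.1.2.2.2.2.1.1
      have hl : l ∈ disc n := h.1.2.2.2.2.2.2.2.1
      have e1 : extFun c (projFun c) ⟨.succ n ξ a' b η l j κ, h⟩ (hatFun φ y) -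
          φ κ * extFun c (projFun c) ⟨.succ n ξ a' b η l j κ, h⟩ y =
          (hatFun φ y ⟨ξ, h.2.1⟩ - φ κ * y ⟨ξ, h.2.1⟩) + ((p.m j : ℂ)⁻¹ * l) *
          (hatFun φ (projFun c b y - projFun c (a' - 1) y) ⟨η, h.2.2.1⟩ -
            φ κ * (projFun c b y - projFun c (a' - 1) y) ⟨η, h.2.2.1⟩) := by
        rw [hatFun_sub, hatFun_projFun, hatFun_projFun]
        simp only [extFun, LinearMap.smul_apply, LinearMap.comp_apply, LinearMap.sub_apply,
          LinearMap.proj_apply, Pi.sub_apply, smul_eq_mul, LinearMap.add_apply]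
        ring
      refine (congrArg norm e1).trans_le ?_
      -- If `ξ` lies below the support of `y`, only the `η` term survives and `γ` behaves like a
      -- node of age 1.
      rcases Nat.lt_or_ge ξ.rank a with h5 | h5
      · rw [h0 ⟨ξ, h.2.1⟩ h5, hatFun_eq_zero fun δ hδ => h0 δ (hδ.trans_lt h5), mul_zero,
          sub_zero, zero_add]
        exact norm_age_one_term_le hM hL0 (hy.sub h2)
          (ih ⟨η, h.2.2.1⟩ h1 ha (hy.sub h2) fun δ hδ => vanish δ hδ b (a' - 1)) hl κ har.le
      have hw : p.weight ξ = (p.m j : ℝ)⁻¹ := h.1.2.2.1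
      have h6 : ξ.rank < n := by omega
      have iξ := ih ⟨ξ, h.2.1⟩ h6 ha hy h0
      -- The induction hypothesis is used with the left end `a'` of `I` in place of `a`, so that the
      -- factor is `weight(I, η)`, which the constraints make small.
      have iη := ih ⟨η, h.2.2.1⟩ h1 (a := a') (by omega) (hy.sub h2) fun δ hδ => by
        rw [Pi.sub_apply, projFun_of_le b y δ (by omega), projFun_of_le (a' - 1) y δ (by omega),
          sub_self]
      -- For even `j` this is a constraint on `Γ`; for odd `j` it comes from `m_{4σ(ξ)} > 2^{rank
      -- ξ}`.
      have hW : p.intervalWeight a' η ≤ ((2 : ℝ) ^ ξ.rank)⁻¹ := by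
        rcases h.2.2.2.2.2 with h6 | h6
        · exact h6.2
        · refine (intervalWeight_le_weight a' η).trans (h6.2.trans_le ?_)
          refine inv_anti₀ (by positivity) ?_
          exact_mod_cast (c.large ξ (IsNode.isBarNode h.2.1)).le
      have b1 : ‖hatFun φ y ⟨ξ, h.2.1⟩ - φ κ * y ⟨ξ, h.2.1⟩‖ ≤ (p.m j : ℝ)⁻¹ *
          (6 + 24 * (1 - 2 ^ a / 2 ^ ξ.rank)) * (M + L / 2 ^ a) * R +
          L * ((p.m j : ℝ)⁻¹ * (2 ^ ξ.rank)⁻¹) * R := by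
        have e2 : hatFun φ y ⟨ξ, h.2.1⟩ - φ κ * y ⟨ξ, h.2.1⟩ =
          (hatFun φ y ⟨ξ, h.2.1⟩ - φ ξ.kappa * y ⟨ξ, h.2.1⟩) +
            (φ ξ.kappa - φ κ) * y ⟨ξ, h.2.1⟩ := by ring
        rw [e2]
        refine (norm_add_le _ _).trans (add_le_add (iξ.trans ?_) ?_)
        · have := (intervalWeight_le_weight (p := p) a ξ).trans_eq hw
          have h8 : (0 : ℝ) ≤ 6 + 24 * (1 - 2 ^ a / 2 ^ ξ.rank) := by
            linarith [two_pow_div_two_pow_le_one h5]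
          gcongr
        · rw [norm_mul]
          have h7 := (hL ξ.kappa κ).trans (mul_le_mul_of_nonneg_left h.2.2.2.1 hL0)
          exact mul_le_mul h7 (hy.norm_apply_le _) (norm_nonneg _) ((norm_nonneg _).trans h7)
      refine (norm_add_le _ _).trans ((add_le_add b1 (norm_coeff_mul_sub_le
        (norm_coeff_le_inv hl) iη ((hL η.kappa κ).trans
          (mul_le_mul_of_nonneg_left h.2.2.2.2.1 hL0)) ((hy.sub h2).norm_apply_le _))).trans ?_)
      have hs : (0 : ℝ) ≤ ((2 : ℝ) ^ ξ.rank)⁻¹ := by positivity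
      refine succ_term_bound (by positivity) hR (by positivity) ?_ (by positivity) ?_ hs
        ?_ ?_ ?_ (intervalWeight_nonneg a' η) hW
      · have : (2 : ℝ) ^ a ≤ 2 ^ a' := pow_le_pow_right₀ (by norm_num) (by omega)
        gcongr
      · have : (0 : ℝ) ≤ 2 ^ a' / 2 ^ η.rank := by positivity
        linarith
      · have e3 : L * ((2 : ℝ) ^ ξ.rank)⁻¹ = L / 2 ^ a * (2 ^ a / 2 ^ ξ.rank) := by field_simp
        rw [e3]
        gcongr
        linarith
      -- The hypothesis `1 ≤ a` yields the factor `1/2` in `s ≤ t / 2`.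
      · have : (2 : ℝ) ≤ 2 ^ a := le_self_pow₀ (by norm_num) (by omega)
        rw [div_div, mul_comm, ← div_div, div_eq_mul_inv (2 ^ a / 2)]
        exact le_mul_of_one_le_left hs (by linarith)
      -- The gap `rank ξ + 2 ≤ n` in the definition of the tuples gives `t' ≤ t / 4`.
      · have : (2 : ℝ) ^ ξ.rank * 4 ≤ 2 ^ n := by
          calc (2 : ℝ) ^ ξ.rank * 4 = 2 ^ (ξ.rank + 2) := by ring
            _ ≤ 2 ^ n := pow_le_pow_right₀ (by norm_num) (by omega)
        rw [div_div]
        change (2 : ℝ) ^ a / 2 ^ n ≤ _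
        gcongr

/-- The tail `x - P_{[1,a]} x` is interval bounded by `4R`, so the error is at most `(30/8) · 4 =
15` and the main term at most 4, in units of `(M + L / 2^{a+1}) R`. -/
theorem norm_hatFun_sub_projFun_le (hM : ∀ κ, ‖φ κ‖ ≤ M) (hL0 : 0 ≤ L)
    (hL : ∀ x y, ‖φ x - φ y‖ ≤ L * rho p.enum x y) (a : ℕ) {R : ℝ}
    {x : Gam c → ℂ} (hx : ∀ γ, ‖x γ‖ ≤ R) (γ : Gam c) :
    ‖hatFun φ x γ - projFun c a (hatFun φ x) γ‖ ≤ 19 * (M + L / 2 ^ (a + 1)) * R := by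
  have hM0 : 0 ≤ M := (norm_nonneg _).trans (hM γ.1.kappa)
  have hR0 : 0 ≤ R := (norm_nonneg _).trans (hx γ)
  have hy := intervalBounded_sub_projFun hx a
  set y := x - projFun c a x with hy_def
  have h0 : ∀ δ : Gam c, δ.1.rank < a + 1 → y δ = 0 := fun δ hδ => by
    rw [hy_def, Pi.sub_apply, projFun_of_le a x δ (by omega), sub_self]
  have h1 := norm_hatFun_sub_le hM hL0 hL γ (Nat.le_add_left 1 a) hy h0
  have h2 : hatFun φ x γ - projFun c a (hatFun φ x) γ = hatFun φ y γ := by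
    rw [hy_def, hatFun_sub, hatFun_projFun, Pi.sub_apply]
  set B := M + L / 2 ^ (a + 1) with hB
  have hMB : M ≤ B := le_add_of_nonneg_right (by positivity)
  have hB0 : 0 ≤ B := hM0.trans hMB
  have h3 : p.intervalWeight (a + 1) γ.1 * (6 + 24 * (1 - 2 ^ (a + 1) / 2 ^ γ.1.rank)) ≤
      1 / 8 * 30 := by
    refine (mul_le_mul_of_nonneg_left (c := 30) ?_ (intervalWeight_nonneg _ _)).trans
      (mul_le_mul_of_nonneg_right ((intervalWeight_le_weight _ _).trans (weight_le γ))
        (by norm_num))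
    have : (0 : ℝ) ≤ 2 ^ (a + 1) / 2 ^ γ.1.rank := by positivity
    linarith
  have h4 : ‖φ γ.1.kappa * y γ‖ ≤ B * (4 * R) := by
    rw [norm_mul]
    exact mul_le_mul ((hM _).trans hMB) (hy.norm_apply_le γ) (norm_nonneg _) hB0
  have h5 : ‖hatFun φ y γ - φ γ.1.kappa * y γ‖ ≤ 1 / 8 * 30 * B * (4 * R) := by
    refine h1.trans ?_
    gcongr
  rw [h2, ← sub_add_cancel (hatFun φ y γ) (φ γ.1.kappa * y γ)]
  refine (norm_add_le _ _).trans ((add_le_add h5 h4).trans (le_of_eq ?_))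
  ring

end Estimate

/-! ### The metric `ϱ` and the sets `𝓑_n` -/

section Metric

theorem norm_enum_le (p : Params K) {i : ℕ} (hi : 1 ≤ i) : ‖p.enum i‖ ≤ 1 := by
  have : p.enum i ∈ p.enum '' Set.Ici 1 := ⟨i, hi, rfl⟩
  rw [p.enum_image] at this
  exact this.2

theorem theta_le_one {n : ℕ} {θ : ℝ} (h : θ ≤ (n : ℝ) / (n + 1)) : θ ≤ 1 :=
  h.trans ((div_le_one (by positivity)).mpr (by linarith))

theorem norm_le_one_of_mem_semigroupB {n : ℕ} {φ : C(K, ℂ)} (h : φ ∈ semigroupB p.enum n) :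
    ‖φ‖ ≤ 1 := by
  obtain ⟨k, -, θ, h0, h1, i, hi, rfl⟩ := h
  rw [norm_smul, norm_pow, Complex.norm_real, Real.norm_of_nonneg h0]
  have hprod : ‖∏ t, p.enum (i t)‖ ≤ 1 := by
    rw [ContinuousMap.norm_le _ zero_le_one]
    intro x
    rw [ContinuousMap.prod_apply, norm_prod]
    exact Finset.prod_le_one (fun _ _ => norm_nonneg _) fun t _ =>
      (ContinuousMap.norm_coe_le_norm _ x).trans (norm_enum_le p (hi t).1)
  exact mul_le_one₀ (pow_le_one₀ h0 (theta_le_one h1)) (norm_nonneg _) hprod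

theorem semigroupB_mono (p : Params K) {n m : ℕ} (h : n ≤ m) :
    semigroupB p.enum n ⊆ semigroupB p.enum m := by
  rintro _ ⟨k, hk, θ, h0, h1, i, hi, rfl⟩
  refine ⟨k, hk, θ, h0, h1.trans ?_, i, fun t => ⟨(hi t).1, (hi t).2.trans h⟩, rfl⟩
  have h' : (n : ℝ) ≤ m := by exact_mod_cast h
  rw [div_le_div_iff₀ (by positivity) (by positivity)]
  nlinarith

/-- The new `θ` is the weighted geometric mean of the two old ones, so it stays below `n / (n + 1)`.
-/
theorem mul_mem_semigroupB {n : ℕ} {φ ψ : C(K, ℂ)} (hφ : φ ∈ semigroupB p.enum n)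
    (hψ : ψ ∈ semigroupB p.enum n) : φ * ψ ∈ semigroupB p.enum n := by
  obtain ⟨k, hk, θ, h0, h1, i, hi, rfl⟩ := hφ
  obtain ⟨l, hl, τ, h0', h1', j, hj, rfl⟩ := hψ
  have hkl : k + l ≠ 0 := by omega
  have hnn : 0 ≤ θ ^ k * τ ^ l := by positivity
  refine ⟨k + l, by omega, (θ ^ k * τ ^ l) ^ ((k + l : ℕ) : ℝ)⁻¹, by positivity, ?_,
    Fin.append i j, ?_, ?_⟩
  · have hq : (0 : ℝ) ≤ (n : ℝ) / (n + 1) := by positivity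
    calc (θ ^ k * τ ^ l) ^ ((k + l : ℕ) : ℝ)⁻¹
        ≤ (((n : ℝ) / (n + 1)) ^ (k + l)) ^ ((k + l : ℕ) : ℝ)⁻¹ := by
          rw [pow_add]
          gcongr
      _ = (n : ℝ) / (n + 1) := Real.pow_rpow_inv_natCast hq hkl
  · intro t
    refine Fin.addCases (fun t => ?_) (fun t => ?_) t
    · rw [Fin.append_left]; exact hi t
    · rw [Fin.append_right]; exact hj t
  · have e : (((θ ^ k * τ ^ l) ^ ((k + l : ℕ) : ℝ)⁻¹ : ℝ) : ℂ) ^ (k + l) =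
        (θ : ℂ) ^ k * (τ : ℂ) ^ l := by
      rw [← Complex.ofReal_pow, Real.rpow_inv_natCast_pow hnn hkl]
      push_cast
      rfl
    rw [Fin.prod_univ_add, e, smul_mul_smul_comm]
    simp only [Fin.append_left, Fin.append_right]

theorem smul_enum_mem_semigroupB (p : Params K) {i n : ℕ} (hi : 1 ≤ i) (hn : i ≤ n) :
    (((n : ℝ) / (n + 1) : ℝ) : ℂ) • p.enum i ∈ semigroupB p.enum n :=
  ⟨1, le_rfl, (n : ℝ) / (n + 1), by positivity, le_rfl, fun _ => i, fun _ => ⟨hi, hn⟩, by simp⟩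

theorem norm_sub_le_two {n : ℕ} {φ : C(K, ℂ)} (h : φ ∈ semigroupB p.enum n) (x y : K) :
    ‖φ x - φ y‖ ≤ 2 := by
  have h1 := norm_le_one_of_mem_semigroupB h
  refine (norm_sub_le _ _).trans ?_
  linarith [φ.norm_coe_le_norm x, φ.norm_coe_le_norm y]

theorem bddAbove_rho (p : Params K) (n : ℕ) (x y : K) :
    BddAbove ((fun φ : C(K, ℂ) => ‖φ x - φ y‖) '' semigroupB p.enum n) := by
  refine ⟨2, ?_⟩
  rintro _ ⟨φ, hφ, rfl⟩
  exact norm_sub_le_two hφ x y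

theorem rho_term_nonneg (p : Params K) (x y : K) (n : ℕ) : 0 ≤ ((2 : ℝ) ^ (n + 1))⁻¹ *
    sSup ((fun φ : C(K, ℂ) => ‖φ x - φ y‖) '' semigroupB p.enum (n + 1)) := by
  refine mul_nonneg (by positivity) (Real.sSup_nonneg ?_)
  rintro _ ⟨φ, -, rfl⟩
  exact norm_nonneg _

theorem summable_rho (p : Params K) (x y : K) : Summable fun n : ℕ => ((2 : ℝ) ^ (n + 1))⁻¹ *
    sSup ((fun φ : C(K, ℂ) => ‖φ x - φ y‖) '' semigroupB p.enum (n + 1)) := by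
  refine Summable.of_nonneg_of_le (rho_term_nonneg p x y) (fun n => ?_)
    (summable_geometric_of_lt_one (r := (1 / 2 : ℝ)) (by norm_num) (by norm_num))
  have h : sSup ((fun φ : C(K, ℂ) => ‖φ x - φ y‖) '' semigroupB p.enum (n + 1)) ≤ 2 := by
    refine Real.sSup_le ?_ (by norm_num)
    rintro _ ⟨φ, hφ, rfl⟩
    exact norm_sub_le_two hφ x y
  refine (mul_le_mul_of_nonneg_left h (by positivity)).trans (le_of_eq ?_)
  rw [pow_succ, one_div, inv_pow]
  field_simp

theorem rho_nonneg (p : Params K) (x y : K) : 0 ≤ rho p.enum x y :=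
  tsum_nonneg (rho_term_nonneg p x y)

/-- The `n`-th term of the series for `ϱ` alone dominates `2^{-n} |φ(x) - φ(y)|`. -/
theorem norm_sub_le_rho {n : ℕ} (hn : 1 ≤ n) {φ : C(K, ℂ)} (h : φ ∈ semigroupB p.enum n)
    (x y : K) : ‖φ x - φ y‖ ≤ 2 ^ n * rho p.enum x y := by
  obtain ⟨n, rfl⟩ : ∃ k, n = k + 1 := ⟨n - 1, by omega⟩
  have h1 := (summable_rho p x y).le_tsum n fun k _ => rho_term_nonneg p x y k
  have h2 : ‖φ x - φ y‖ ≤ _ := le_csSup (bddAbove_rho p (n + 1) x y) ⟨φ, h, rfl⟩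
  rw [← inv_mul_le_iff₀ (by positivity)]
  exact (mul_le_mul_of_nonneg_left h2 (by positivity)).trans h1

theorem IsLip.exists_nonneg {φ : C(K, ℂ)} (h : IsLip p φ) :
    ∃ L : ℝ, 0 ≤ L ∧ ∀ x y : K, ‖φ x - φ y‖ ≤ L * rho p.enum x y := by
  obtain ⟨L, hL⟩ := h
  refine ⟨|L|, abs_nonneg L, fun x y => (hL x y).trans ?_⟩
  exact mul_le_mul_of_nonneg_right (le_abs_self L) (rho_nonneg p x y)

theorem isLip_of_mem_semigroupB {n : ℕ} (hn : 1 ≤ n) {φ : C(K, ℂ)}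
    (h : φ ∈ semigroupB p.enum n) : IsLip p φ :=
  ⟨2 ^ n, norm_sub_le_rho hn h⟩

variable (p) in
/-- The algebra of the `ϱ`-Lipschitz functions. -/
def lipAlgebra : Subalgebra ℂ C(K, ℂ) where
  carrier := {φ | IsLip p φ}
  add_mem' := by
    rintro f g ⟨L, hL⟩ ⟨L', hL'⟩
    refine ⟨L + L', fun x y => ?_⟩
    rw [ContinuousMap.add_apply, ContinuousMap.add_apply, add_sub_add_comm, add_mul]
    exact (norm_add_le _ _).trans (add_le_add (hL x y) (hL' x y))
  mul_mem' := by
    rintro f g ⟨L, hL⟩ ⟨L', hL'⟩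
    refine ⟨L * ‖g‖ + ‖f‖ * L', fun x y => ?_⟩
    have e : (f * g) x - (f * g) y = (f x - f y) * g x + f y * (g x - g y) := by
      rw [ContinuousMap.mul_apply, ContinuousMap.mul_apply]; ring
    have h1 : ‖(f x - f y) * g x‖ ≤ L * rho p.enum x y * ‖g‖ := by
      rw [norm_mul]
      exact mul_le_mul (hL x y) (g.norm_coe_le_norm x) (norm_nonneg _)
        ((norm_nonneg _).trans (hL x y))
    have h2 : ‖f y * (g x - g y)‖ ≤ ‖f‖ * (L' * rho p.enum x y) := by
      rw [norm_mul]
      exact mul_le_mul (f.norm_coe_le_norm y) (hL' x y) (norm_nonneg _) (norm_nonneg _)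
    rw [e]
    refine (norm_add_le _ _).trans ((add_le_add h1 h2).trans (le_of_eq ?_))
    ring
  algebraMap_mem' := fun a => ⟨0, fun x y => by simp⟩

theorem smul_mem_A (p : Params K) {f : C(K, ℂ)} (hf : f ∈ p.A) (q : ℚ) : (q : ℂ) • f ∈ p.A := by
  have := p.A_comb f hf f hf (q : ℂ) ⟨q, 0, by simp⟩ 0 ⟨0, 0, by simp⟩
  simpa using this

theorem exists_enum_eq (p : Params K) {f : C(K, ℂ)} (hf : f ∈ p.A) {q : ℚ} (hq0 : 0 < q)
    (hq : ‖f‖ ≤ q) : ∃ i, 1 ≤ i ∧ f = (q : ℂ) • p.enum i := by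
  have hq0' : (0 : ℝ) < q := by exact_mod_cast hq0
  have h : ((q⁻¹ : ℚ) : ℂ) • f ∈ p.enum '' Set.Ici 1 := by
    rw [p.enum_image]
    refine ⟨smul_mem_A p hf _, ?_⟩
    rw [norm_smul, Rat.cast_inv, norm_inv, Complex.norm_ratCast, abs_of_pos hq0',
      inv_mul_le_iff₀ hq0', mul_one]
    exact hq
  obtain ⟨i, hi, h⟩ := h
  refine ⟨i, hi, ?_⟩
  rw [h, smul_smul, Rat.cast_inv, mul_inv_cancel₀ (by exact_mod_cast hq0.ne'), one_smul]

theorem isLip_enum (p : Params K) {i : ℕ} (hi : 1 ≤ i) : IsLip p (p.enum i) := by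
  have h := (lipAlgebra p).smul_mem
    (isLip_of_mem_semigroupB hi (smul_enum_mem_semigroupB p hi le_rfl))
    ((((i : ℝ) / (i + 1) : ℝ) : ℂ)⁻¹)
  rw [smul_smul, inv_mul_cancel₀, one_smul] at h
  · exact h
  · have : (0 : ℝ) < i := by exact_mod_cast hi
    exact_mod_cast (by positivity : (i : ℝ) / (i + 1) ≠ 0)

theorem isLip_of_mem_A {f : C(K, ℂ)} (hf : f ∈ p.A) : IsLip p f := by
  obtain ⟨q, hq⟩ := exists_rat_gt ‖f‖
  have hq0 : 0 < q := by exact_mod_cast (norm_nonneg f).trans_lt hq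
  obtain ⟨i, hi, e⟩ := exists_enum_eq p hf hq0 hq.le
  rw [e]
  exact (lipAlgebra p).smul_mem (isLip_enum p hi) _

theorem dense_lipAlgebra (p : Params K) : Dense (lipAlgebra p : Set C(K, ℂ)) :=
  p.A_dense.mono fun _ hf => isLip_of_mem_A hf

end Metric

/-! ### Finiteness of the levels of the index set -/

theorem finite_disc (n : ℕ) : (disc n).Finite := by
  refine (((Set.finite_Iic (2 ^ n)).prod (Set.finite_Iic (2 ^ n))).image fun k : ℕ × ℕ =>
    ((k.1 : ℂ) / 2 ^ n) * Complex.exp (((k.2 : ℂ) / 2 ^ n) * (2 * Real.pi) * Complex.I)).subset ?_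
  rintro _ ⟨k₁, k₂, -, h1, -, h2, rfl⟩
  exact ⟨(k₁, k₂), ⟨h1, h2⟩, rfl⟩

theorem finite_isBarNode (p : Params K) (n : ℕ) :
    {γ : Node K | p.IsBarNode γ ∧ γ.rank ≤ n}.Finite := by
  induction n with
  | zero =>
    refine Set.finite_empty.subset fun γ h => ?_
    obtain ⟨h, h'⟩ := h
    match γ with
    | .base _ _ => simp only [Node.rank] at h'; have := h.1; omega
    | .age1 _ _ _ _ _ _ _ => simp only [Node.rank] at h'; have := h.1; omega
    | .succ _ _ _ _ _ _ _ _ => simp only [Node.rank] at h'; have := h.2.1; omega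
  | succ n ih =>
    set F := {γ : Node K | p.IsBarNode γ ∧ γ.rank ≤ n}
    have hJ : (Set.Iic (n + 1)).Finite := Set.finite_Iic _
    have hN : (⋃ m ∈ Set.Iic (n + 1), (p.net m : Set K)).Finite :=
      hJ.biUnion fun m _ => (p.net m).finite_toSet
    have hD : (⋃ m ∈ Set.Iic (n + 1), disc m).Finite := hJ.biUnion fun m _ => finite_disc m
    refine ((((hJ.prod hN).image fun t => Node.base t.1 t.2).union
      ((hJ.prod (hJ.prod (hJ.prod (ih.prod (hD.prod (hJ.prod hN)))))).image fun t =>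
        Node.age1 t.1 t.2.1 t.2.2.1 t.2.2.2.1 t.2.2.2.2.1 t.2.2.2.2.2.1 t.2.2.2.2.2.2)).union
      ((hJ.prod (ih.prod (hJ.prod (hJ.prod (ih.prod (hD.prod (hJ.prod hN))))))).image fun t =>
        Node.succ t.1 t.2.1 t.2.2.1 t.2.2.2.1 t.2.2.2.2.1 t.2.2.2.2.2.1 t.2.2.2.2.2.2.1
          t.2.2.2.2.2.2.2)).subset ?_
    rintro γ ⟨h, h'⟩
    match γ with
    | .base m κ =>
      exact .inl (.inl ⟨(m, κ), ⟨h', Set.mem_biUnion (Set.mem_Iic.2 h') h.2⟩, rfl⟩)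
    | .age1 m a b η l j κ =>
      have h'' : m ≤ n + 1 := h'
      obtain ⟨h1, h2, h3, h4, h5, h6, h7⟩ := h
      have ha : a ≤ n + 1 := by omega
      have hb : b ≤ n + 1 := by omega
      have hη : η.rank ≤ n := by omega
      have hj : j ≤ n + 1 := by omega
      exact .inl (.inr ⟨(m, a, b, η, l, j, κ), ⟨h', ha, hb, ⟨h2, hη⟩, Set.mem_biUnion h' h4, hj,
        Set.mem_biUnion h' h7⟩, rfl⟩)
    | .succ m ξ a b η l j κ =>
      have h'' : m ≤ n + 1 := h'
      obtain ⟨h1, h2, -, -, h3, h4, h5, h6, h7, h8, h9⟩ := h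
      have ha : a ≤ n + 1 := by omega
      have hb : b ≤ n + 1 := by omega
      have hξ : ξ.rank ≤ n := by omega
      have hη : η.rank ≤ n := by omega
      have hj : j ≤ n + 1 := by omega
      exact .inr ⟨(m, ξ, a, b, η, l, j, κ), ⟨h', ⟨h1, hξ⟩, ha, hb, ⟨h4, hη⟩,
        Set.mem_biUnion h' h6, hj, Set.mem_biUnion h' h9⟩, rfl⟩

theorem finite_rank_le (n : ℕ) : {γ : Gam c | γ.1.rank ≤ n}.Finite :=
  Set.Finite.of_finite_image (f := Subtype.val)
    ((finite_isBarNode p n).subset (by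
      rintro _ ⟨γ, h, rfl⟩
      exact ⟨IsNode.isBarNode γ.2, h⟩)) Subtype.val_injective.injOn

/-! ### Operators on `𝔛_{C(K)}` -/

theorem proj_apply (k : ℕ) (x : LInf c) (γ : Gam c) : proj c k x γ = projFun c k x γ := rfl

theorem proj_zero : proj c 0 = 0 := by
  ext x γ
  rw [proj_apply, projFun_zero]
  rfl

theorem proj_proj (k n : ℕ) (x : LInf c) : proj c n (proj c k x) = proj c (min n k) x := by
  ext γ
  exact congrFun (projFun_projFun k n x) γ

theorem exists_norm_hatFun_le {φ : C(K, ℂ)} (h : IsLip p φ) :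
    ∃ C : ℝ, ∀ (x : LInf c) (γ : Gam c), ‖hatFun φ x γ‖ ≤ C * ‖x‖ := by
  obtain ⟨L, hL0, hL⟩ := h.exists_nonneg
  refine ⟨19 * (‖φ‖ + L / 2 ^ (0 + 1)), fun x γ => ?_⟩
  have := norm_hatFun_sub_projFun_le (φ := φ) (fun κ => φ.norm_coe_le_norm κ) hL0 hL 0
    (fun γ => lp.norm_apply_le_norm (by simp) x γ) γ
  rwa [projFun_zero, Pi.zero_apply, sub_zero] at this

theorem memlp_hatFun {φ : C(K, ℂ)} (h : IsLip p φ) (x : LInf c) :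
    Memℓp (hatFun φ (x : Gam c → ℂ)) ∞ := by
  obtain ⟨C, hC⟩ := exists_norm_hatFun_le (c := c) h
  refine memℓp_infty ⟨C * ‖x‖, ?_⟩
  rintro _ ⟨γ, rfl⟩
  exact hC x γ

variable (c) in
/-- The operator `φ̂` on `ℓ_∞(Γ)`. -/
def hatLInf {φ : C(K, ℂ)} (h : IsLip p φ) : LInf c →L[ℂ] LInf c :=
  LinearMap.mkContinuousOfExistsBound
    { toFun := fun x => ⟨hatFun φ x, memlp_hatFun h x⟩
      map_add' := fun x y => by ext γ; exact congrFun (hatFun_add φ x y) γ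
      map_smul' := fun a x => by ext γ; exact congrFun (hatFun_smul φ a x) γ }
    (by
      obtain ⟨C, hC⟩ := exists_norm_hatFun_le (c := c) h
      refine ⟨|C|, fun x => lp.norm_le_of_forall_le (by positivity) fun γ => (hC x γ).trans ?_⟩
      exact mul_le_mul_of_nonneg_right (le_abs_self C) (norm_nonneg x))

theorem hatLInf_apply {φ : C(K, ℂ)} (h : IsLip p φ) (x : LInf c) (γ : Gam c) :
    hatLInf c h x γ = hatFun φ x γ := rfl

theorem hatLInf_proj {φ : C(K, ℂ)} (h : IsLip p φ) (k : ℕ) (x : LInf c) :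
    hatLInf c h (proj c k x) = proj c k (hatLInf c h x) := by
  ext γ
  exact congrFun (hatFun_projFun φ k x) γ

theorem norm_hatLInf_sub_proj_le {φ : C(K, ℂ)} (h : IsLip p φ) {M L : ℝ} (hM : ‖φ‖ ≤ M)
    (hL0 : 0 ≤ L) (hL : ∀ x y, ‖φ x - φ y‖ ≤ L * rho p.enum x y) (a : ℕ) (x : LInf c) :
    ‖hatLInf c h x - proj c a (hatLInf c h x)‖ ≤ 19 * (M + L / 2 ^ (a + 1)) * ‖x‖ := by
  have hM0 : 0 ≤ M := (norm_nonneg _).trans hM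
  exact lp.norm_le_of_forall_le (by positivity) fun γ =>
    norm_hatFun_sub_projFun_le (fun κ => (φ.norm_coe_le_norm κ).trans hM) hL0 hL a
      (fun γ => lp.norm_apply_le_norm (by simp) x γ) γ

/-- Commuting with the projections preserves each range `Y_n`, and continuity preserves the closure.
-/
theorem mapsTo_spaceX {T : LInf c →L[ℂ] LInf c} (h : ∀ k x, T (proj c k x) = proj c k (T x))
    {x : LInf c} (hx : x ∈ spaceX c) : T x ∈ spaceX c := by
  have hS : (⨆ n : ℕ, LinearMap.range (proj c n : LInf c →ₗ[ℂ] LInf c)) ≤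
      (⨆ n : ℕ, LinearMap.range (proj c n : LInf c →ₗ[ℂ] LInf c)).comap
        (T : LInf c →ₗ[ℂ] LInf c) := by
    refine iSup_le fun n => ?_
    rintro _ ⟨y, rfl⟩
    exact Submodule.mem_iSup_of_mem n ⟨T y, (h n y).symm⟩
  exact map_mem_closure T.continuous hx fun y hy => hS hy

/-- The restriction to `𝔛_{C(K)}` of an operator that commutes with the projections. -/
def restrictX (T : LInf c →L[ℂ] LInf c) (h : ∀ k x, T (proj c k x) = proj c k (T x)) :
    X c →L[ℂ] X c :=
  (T.comp (spaceX c).subtypeL).codRestrict (spaceX c) fun x => mapsTo_spaceX h x.2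

variable (c) in
/-- The projection `P_{[1,k]}` on `𝔛_{C(K)}`. -/
def projX (k : ℕ) : X c →L[ℂ] X c :=
  restrictX (proj c k) fun n x => by rw [proj_proj, proj_proj, min_comm]

variable (c) in
/-- The operator `φ̂` on `𝔛_{C(K)}`. -/
def hat {φ : C(K, ℂ)} (h : IsLip p φ) : X c →L[ℂ] X c :=
  restrictX (hatLInf c h) (hatLInf_proj h)

theorem coe_hat {φ : C(K, ℂ)} (h : IsLip p φ) (x : X c) :
    (hat c h x : LInf c) = hatLInf c h x := rfl

theorem projX_hat {φ : C(K, ℂ)} (h : IsLip p φ) (k : ℕ) (x : X c) :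
    projX c k (hat c h x) = hat c h (projX c k x) :=
  Subtype.ext (hatLInf_proj h k (x : LInf c)).symm

theorem projX_projX (k n : ℕ) (x : X c) : projX c n (projX c k x) = projX c (min n k) x :=
  Subtype.ext (proj_proj k n (x : LInf c))

/-! ### Basis vectors and uniqueness of `φ̂` -/

theorem basisVec_apply_of_rank_le {γ δ : Gam c} (h : δ.1.rank ≤ γ.1.rank) [Decidable (δ = γ)] :
    (basisVec c γ : LInf c) δ = if δ = γ then 1 else 0 := by
  classical
  have : (basisVec c γ : LInf c) δ = (Pi.single γ (1 : ℂ) : Gam c → ℂ) δ :=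
    projFun_of_le _ _ _ h
  rw [this, Pi.single_apply]
  congr

theorem basisVec_apply_self (γ : Gam c) : (basisVec c γ : LInf c) γ = 1 := by
  classical
  rw [basisVec_apply_of_rank_le le_rfl, if_pos rfl]

theorem basisVec_apply_of_rank_lt {γ δ : Gam c} (h : δ.1.rank < γ.1.rank) :
    (basisVec c γ : LInf c) δ = 0 := by
  classical
  rw [basisVec_apply_of_rank_le h.le, if_neg]
  rintro rfl
  exact lt_irrefl _ h

theorem norm_basisVec_le (γ : Gam c) : ‖basisVec c γ‖ ≤ 2 := by
  classical
  refine lp.norm_le_of_forall_le (by norm_num) fun δ => ?_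
  refine (norm_projFun_le _ 1 (fun δ => ?_) γ.1.rank δ).trans (by norm_num)
  rw [lp.single_apply, Pi.single_apply]
  split_ifs <;> simp

theorem isHat_hat {φ : C(K, ℂ)} (h : IsLip p φ) : IsHat c φ (hat c h) := by
  classical
  intro γ
  ext δ
  set e : Gam c → ℂ := Pi.single γ (1 : ℂ) with he
  have e0 : ((basisVec c γ : LInf c) : Gam c → ℂ) = projFun c γ.1.rank e := by
    rw [he]
    change projFun c γ.1.rank _ = _
    rw [lp.coeFn_single]
  have e1 : (hat c h (basisVec c γ) : LInf c) δ = hatFun φ (projFun c γ.1.rank e) δ := by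
    rw [coe_hat, hatLInf_apply, e0]
  have e2 : ((φ γ.1.kappa • basisVec c γ : X c) : LInf c) δ =
      projFun c γ.1.rank (φ γ.1.kappa • e) δ := by
    rw [map_smul, ← e0]
    rfl
  rw [e1, e2, hatFun_projFun]
  refine projFun_congr _ _ _ _ fun δ' _ hδ' => ?_
  rw [hatFun_apply_of_forall_lt fun δ'' h'' => ?_, Pi.smul_apply, smul_eq_mul]
  · rw [he, Pi.single_apply]
    split_ifs with h'
    · rw [h']
    · simp
  · rw [he, Pi.single_apply, if_neg]
    rintro rfl
    omega

variable (c) in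
/-- The range of `P_{[1,n]}` is spanned by the `d_γ` of rank at most `n`. -/
theorem proj_mem_span (n : ℕ) (x : LInf c) : proj c n x ∈
    Submodule.span ℂ ((fun γ => (basisVec c γ : LInf c)) '' {γ : Gam c | γ.1.rank ≤ n}) := by
  classical
  induction n with
  | zero => rw [proj_zero]; exact Submodule.zero_mem _
  | succ n ih =>
    set y : LInf c := x - proj c n x with hy
    have hfin : {γ : Gam c | γ.1.rank = n + 1}.Finite :=
      (finite_rank_le (n + 1)).subset fun γ h => (show γ.1.rank = n + 1 from h).le
    have key : proj c (n + 1) x =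
        proj c n x + ∑ γ ∈ hfin.toFinset, y γ • (basisVec c γ : LInf c) := by
      have e1 : ∑ γ ∈ hfin.toFinset, y γ • (basisVec c γ : LInf c) =
          proj c (n + 1) (∑ γ ∈ hfin.toFinset, y γ • lp.single ∞ γ (1 : ℂ)) := by
        rw [map_sum]
        refine Finset.sum_congr rfl fun γ hγ => ?_
        have hγ' : γ.1.rank = n + 1 := hfin.mem_toFinset.1 hγ
        rw [map_smul, ← hγ']
        congr!
      have e2 : proj c (n + 1) y = proj c (n + 1) x - proj c n x := by
        rw [hy, map_sub, proj_proj, min_eq_right (by omega)]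
      rw [e1, ← sub_eq_iff_eq_add', ← e2]
      ext γ
      refine projFun_congr _ _ _ _ fun δ _ hδ => ?_
      rw [lp.coeFn_sum, Finset.sum_apply]
      simp only [lp.coeFn_smul, Pi.smul_apply, lp.single_apply, Pi.single_apply, smul_eq_mul,
        mul_ite, mul_one, mul_zero, Finset.sum_ite_eq, Set.Finite.mem_toFinset, Set.mem_ofPred_eq]
      split_ifs with h
      · rfl
      · rw [hy, lp.coeFn_sub, Pi.sub_apply, proj_apply, projFun_of_le n _ _ (by omega), sub_self]
    rw [key]
    refine Submodule.add_mem _ (Submodule.span_mono (Set.image_mono fun γ h => ?_) ih)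
      (Submodule.sum_mem _ fun γ hγ => Submodule.smul_mem _ _ (Submodule.subset_span ⟨γ, ?_, rfl⟩))
    · exact Nat.le_succ_of_le h
    · exact (show γ.1.rank = n + 1 from hfin.mem_toFinset.1 hγ).le

/-- The levels of `Γ` are finite, so the `d_γ` span every `Y_n`, and their span is dense. -/
theorem clm_ext_basisVec {T S : X c →L[ℂ] X c}
    (h : ∀ γ, T (basisVec c γ) = S (basisVec c γ)) : T = S := by
  set E : Submodule ℂ (X c) := LinearMap.eqLocus (T : X c →ₗ[ℂ] X c) (S : X c →ₗ[ℂ] X c) with hE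
  have hEc : IsClosed (E : Set (X c)) := isClosed_eq T.continuous S.continuous
  have hX : IsClosed (spaceX c : Set (LInf c)) := Submodule.isClosed_topologicalClosure _
  have hmap : IsClosed ((E.map (spaceX c).subtype : Submodule ℂ (LInf c)) : Set (LInf c)) :=
    hX.isClosedEmbedding_subtypeVal.isClosedMap _ hEc
  have hle : (⨆ n : ℕ, LinearMap.range (proj c n : LInf c →ₗ[ℂ] LInf c)) ≤
      E.map (spaceX c).subtype := by
    refine iSup_le fun n => ?_
    rintro _ ⟨y, rfl⟩
    refine Submodule.span_le.2 ?_ (proj_mem_span c n y)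
    rintro _ ⟨γ, -, rfl⟩
    exact ⟨basisVec c γ, h γ, rfl⟩
  ext1 x
  obtain ⟨y, hy, hyx⟩ := Submodule.topologicalClosure_minimal _ hle hmap x.2
  have : y = x := Subtype.ext hyx
  exact this ▸ hy

theorem IsHat.unique {φ : C(K, ℂ)} {T S : X c →L[ℂ] X c} (hT : IsHat c φ T) (hS : IsHat c φ S) :
    T = S :=
  clm_ext_basisVec fun γ => (hT γ).trans (hS γ).symm

theorem IsHat.eq_hat {φ : C(K, ℂ)} {T : X c →L[ℂ] X c} (hT : IsHat c φ T) (h : IsLip p φ) :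
    T = hat c h :=
  hT.unique (isHat_hat h)

theorem IsHat.comp {φ ψ : C(K, ℂ)} {T S : X c →L[ℂ] X c} (hT : IsHat c φ T) (hS : IsHat c ψ S) :
    IsHat c (φ * ψ) (T * S) := fun γ => by
  rw [mul_apply_eq_comp, hS γ, map_smul, hT γ, smul_smul, mul_comm,
    ContinuousMap.mul_apply]

theorem isCompactOperator_projX (k : ℕ) : IsCompactOperator (projX c k) := by
  set V : Submodule ℂ (X c) :=
    Submodule.span ℂ (basisVec c '' {γ : Gam c | γ.1.rank ≤ k}) with hV
  have hfin : FiniteDimensional ℂ V :=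
    FiniteDimensional.span_of_finite ℂ ((finite_rank_le k).image _)
  have hmem : ∀ x, projX c k x ∈ V := fun x => by
    have h := proj_mem_span c k x
    rw [← Set.image_image (Subtype.val : X c → LInf c) (basisVec c)] at h
    have h' := (Submodule.map_span (spaceX c).subtype
      (basisVec c '' {γ : Gam c | γ.1.rank ≤ k})).symm.le h
    obtain ⟨y, hy, hyx⟩ := h'
    have : y = projX c k x := Subtype.ext hyx
    exact this ▸ hy
  have hloc : LocallyCompactSpace V := have := FiniteDimensional.proper ℂ V; inferInstance
  exact (isCompactOperator_of_locallyCompactSpace_dom ((projX c k).codRestrict V hmem)).clm_comp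
    V.subtypeL

/-! ### Calkin algebras -/

section Calkin

variable {E : Type u} [NormedAddCommGroup E] [NormedSpace ℂ E]

/-- Separate continuity of the product, inherited through the quotient map, is all that extending
homomorphisms by density requires. -/
theorem continuous_mk_mul (S : E →L[ℂ] E) :
    Continuous fun y : Calkin E => Ideal.Quotient.mk (compactIdeal E) S * y := by
  refine isQuotientMap_quot_mk.continuous_iff.2 ?_
  exact continuous_quot_mk.comp (continuous_const.mul continuous_id)

theorem continuous_mul_mk (S : E →L[ℂ] E) :
    Continuous fun y : Calkin E => y * Ideal.Quotient.mk (compactIdeal E) S := by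
  refine isQuotientMap_quot_mk.continuous_iff.2 ?_
  exact continuous_quot_mk.comp (continuous_id.mul continuous_const)

theorem Calkin.continuous_const_mul (x : Calkin E) : Continuous fun y : Calkin E => x * y := by
  obtain ⟨S, rfl⟩ := Ideal.Quotient.mk_surjective x
  exact continuous_mk_mul S

theorem Calkin.continuous_mul_const (x : Calkin E) : Continuous fun y : Calkin E => y * x := by
  obtain ⟨S, rfl⟩ := Ideal.Quotient.mk_surjective x
  exact continuous_mul_mk S

variable (ν : EquivalentNorm E)

/-- `T ↦ [T]` as a homomorphism of algebras. -/
def calkinHom : (E →L[ℂ] E) →ₐ[ℂ] Calkin (Renormed ν) :=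
  (Ideal.Quotient.mkₐ ℂ (compactIdeal (Renormed ν))).comp
    ((toRenormed ν).conjContinuousAlgEquiv : (E →L[ℂ] E) →ₐ[ℂ] (Renormed ν →L[ℂ] Renormed ν))

theorem calkinHom_sub_of_isCompactOperator (S : E →L[ℂ] E) {T : E →L[ℂ] E}
    (h : IsCompactOperator T) : calkinHom ν (S - T) = calkinHom ν S := by
  rw [map_sub, sub_eq_self]
  refine Ideal.Quotient.eq_zero_iff_mem.2 ?_
  exact (h.clm_comp (toRenormed ν : E →L[ℂ] Renormed ν)).comp_clm
    ((toRenormed ν).symm : Renormed ν →L[ℂ] E)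

variable [CompleteSpace E]

set_option synthInstance.maxHeartbeats 200000 in
instance Calkin.t2Space : T2Space (Calkin E) := inferInstance

theorem Calkin.norm_smul (a : ℂ) (x : Calkin E) : ‖a • x‖ = ‖a‖ * ‖x‖ := by
  let : NormedSpace ℂ (Calkin E) := Submodule.Quotient.normedSpace (compactIdeal E) ℂ
  exact _root_.norm_smul a x

/-- A bounded homomorphism from a dense subalgebra to a Calkin algebra extends continuously. -/
theorem exists_algHom_extension {A : Type*} [NormedRing A] [NormedAlgebra ℂ A]
    (S : Subalgebra ℂ A) (hS : Dense (S : Set A)) (f : S →ₐ[ℂ] Calkin E) (C : ℝ)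
    (hf : ∀ x, ‖f x‖ ≤ C * ‖x‖) :
    ∃ g : A →ₐ[ℂ] Calkin E, Continuous g ∧ ∀ x : S, g x = f x := by
  let e : S →L[ℂ] A := (Subalgebra.toSubmodule S).subtypeL
  let f' : S →L[ℂ] Calkin E := f.toLinearMap.mkContinuous C hf
  have he : DenseRange e := hS.denseRange_val
  let g : A →L[ℂ] Calkin E := f'.extend e
  have hg : ∀ x : S, g x = f x :=
    f'.extend_eq he isUniformEmbedding_subtype_val.isUniformInducing
  -- Multiplicativity is extended one factor at a time.
  have hmul1 : ∀ (x : A) (y : S), g (x * y) = g x * g y := fun x y => by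
    refine congrFun (Continuous.ext_on hS (g.continuous.comp (continuous_id.mul continuous_const))
      ((Calkin.continuous_mul_const (g y)).comp g.continuous) fun z hz => ?_) x
    change g (z * y) = g z * g y
    have := hg (⟨z, hz⟩ * y)
    rw [map_mul, ← hg, ← hg] at this
    exact this
  have hmul : ∀ x y : A, g (x * y) = g x * g y := fun x y => by
    refine congrFun (Continuous.ext_on hS (g.continuous.comp (continuous_const.mul continuous_id))
      ((Calkin.continuous_const_mul (g x)).comp g.continuous) fun z hz => ?_) y
    exact hmul1 x ⟨z, hz⟩
  have hone : g 1 = 1 := by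
    have := hg 1
    rw [map_one] at this
    exact this
  exact ⟨AlgHom.ofLinearMap g.toLinearMap hone hmul, g.continuous, hg⟩

/-- An operator with a bounded separated sequence of eigenvectors has large norm modulo the
compact operators. -/
theorem norm_le_norm_mk_of_eigenvectors {T : E →L[ℂ] E} {a : ℂ} {v : ℕ → E} {C δ : ℝ}
    (hv : ∀ k, T (v k) = a • v k) (hC : ∀ k, ‖v k‖ ≤ C) (hδ : 0 < δ)
    (hsep : ∀ k l, k < l → δ ≤ ‖v k - v l‖) :
    ‖a‖ ≤ ‖(Ideal.Quotient.mk (compactIdeal E) T : Calkin E)‖ := by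
  by_contra! hlt
  -- A compact perturbation `S` of `T` with `‖S‖ < ‖a‖` is chosen. Along a subsequence `(S - T) v_k`
  -- converges, yet its differences `S z - a z` have norm at least `(‖a‖ - ‖S‖) δ`.
  obtain ⟨S, hS, hSn⟩ := Submodule.Quotient.norm_mk_lt
    (Ideal.Quotient.mk (compactIdeal E) T : Calkin E) (sub_pos.2 hlt)
  rw [add_sub_cancel] at hSn
  have hcomp : IsCompactOperator (S - T : E →L[ℂ] E) := by
    have : S - T ∈ compactIdeal E := Ideal.Quotient.eq.1 hS
    exact this
  obtain ⟨Q, hQ, hQsub⟩ := IsCompactOperator.image_closedBall_subset_compact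
    (f := (S - T : E →L[ℂ] E).toLinearMap) hcomp C
  obtain ⟨w, -, ψ, hψ, hw⟩ := hQ.tendsto_subseq (x := fun k => (S - T) (v k)) fun k =>
    hQsub ⟨v k, by simpa using hC k, rfl⟩
  have hε : 0 < (‖a‖ - ‖S‖) * δ := mul_pos (sub_pos.2 hSn) hδ
  obtain ⟨N, hN⟩ := Metric.cauchySeq_iff.1 hw.cauchySeq _ hε
  have h1 := hN N le_rfl (N + 1) (Nat.le_succ N)
  have h2 := hsep (ψ N) (ψ (N + 1)) (hψ (Nat.lt_succ_self N))
  set z := v (ψ N) - v (ψ (N + 1)) with hz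
  have h3 : (S - T) (v (ψ N)) - (S - T) (v (ψ (N + 1))) = S z - a • z := by
    rw [← map_sub, ← hz, sub_apply, hz, map_sub T, hv, hv, smul_sub]
  rw [Function.comp_apply, Function.comp_apply, dist_eq_norm, h3, norm_sub_rev] at h1
  have h4 : ‖a‖ * ‖z‖ - ‖S‖ * ‖z‖ ≤ ‖a • z - S z‖ := by
    have := norm_sub_norm_le (a • z) (S z)
    rw [norm_smul] at this
    linarith [S.le_opNorm z]
  have h5 : (‖a‖ - ‖S‖) * δ ≤ (‖a‖ - ‖S‖) * ‖z‖ :=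
    mul_le_mul_of_nonneg_left h2 (sub_pos.2 hSn).le
  linarith

theorem norm_calkinHom_le {T : E →L[ℂ] E} {C : ℝ} (hC : 0 ≤ C)
    (h : ∀ x, ν.toSeminorm (T x) ≤ C * ν.toSeminorm x) : ‖calkinHom ν T‖ ≤ C := by
  refine (Submodule.Quotient.norm_mk_le _ _).trans (ContinuousLinearMap.opNorm_le_bound _ hC ?_)
  exact fun x => h ((toRenormed ν).symm x)

theorem exists_norm_calkinHom_le : ∃ D : ℝ, 0 ≤ D ∧ ∀ (T : E →L[ℂ] E) (C : ℝ), 0 ≤ C →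
    (∀ x, ‖T x‖ ≤ C * ‖x‖) → ‖calkinHom ν T‖ ≤ D * C := by
  obtain ⟨a, ha, hl⟩ := ν.lower
  obtain ⟨b, hu⟩ := ν.upper
  refine ⟨|b| * a⁻¹, by positivity, fun T C hC h => norm_calkinHom_le ν (by positivity) fun x => ?_⟩
  have h1 : ‖x‖ ≤ a⁻¹ * ν.toSeminorm x := by
    rw [le_inv_mul_iff₀ ha]; exact hl x
  calc ν.toSeminorm (T x) ≤ b * ‖T x‖ := hu _
    _ ≤ |b| * (C * (a⁻¹ * ν.toSeminorm x)) := by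
        refine mul_le_mul (le_abs_self b) ((h x).trans (by gcongr)) (norm_nonneg _) (abs_nonneg b)
    _ = |b| * a⁻¹ * C * ν.toSeminorm x := by ring

theorem norm_le_norm_calkinHom_of_eigenvectors {T : E →L[ℂ] E} {a : ℂ} {v : ℕ → E} {C δ : ℝ}
    (hv : ∀ k, T (v k) = a • v k) (hC : ∀ k, ‖v k‖ ≤ C) (hδ : 0 < δ)
    (hsep : ∀ k l, k < l → δ ≤ ‖v k - v l‖) : ‖a‖ ≤ ‖calkinHom ν T‖ := by
  obtain ⟨m, hm, hl⟩ := ν.lower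
  obtain ⟨b, hu⟩ := ν.upper
  refine norm_le_norm_mk_of_eigenvectors (v := fun k => toRenormed ν (v k)) (C := |b| * C)
    (δ := m * δ) (fun k => ?_) (fun k => ?_) (by positivity) fun k l hkl => ?_
  · exact congrArg (toRenormed ν) (hv k)
  · refine (hu _).trans (mul_le_mul (le_abs_self b) (hC k) (norm_nonneg _) (abs_nonneg b))
  · exact (mul_le_mul_of_nonneg_left (hsep k l hkl) hm.le).trans (hl _)

/-! ### Homomorphisms from the algebra of Lipschitz functions -/

section LipHom

variable {f : lipAlgebra p →ₐ[ℂ] Calkin E}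

/-- The function `φ_i` itself need not lie in any `𝓑_n`, but `n/(n+1) φ_i` lies in `𝓑_n` for all `n
≥ i`. -/
theorem norm_algHom_enum_le
    (hf : ∀ φ : lipAlgebra p, ∀ n, 1 ≤ n → (φ : C(K, ℂ)) ∈ semigroupB p.enum n → ‖f φ‖ ≤ 1)
    {i : ℕ} (hi : 1 ≤ i) : ‖f ⟨p.enum i, isLip_enum p hi⟩‖ ≤ 1 := by
  set z : lipAlgebra p := ⟨p.enum i, isLip_enum p hi⟩ with hz
  have h1 : ∀ n, i ≤ n → (n : ℝ) / (n + 1) * ‖f z‖ ≤ 1 := fun n hn => by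
    have h3 := hf ((((n : ℝ) / (n + 1) : ℝ) : ℂ) • z) n (hi.trans hn)
      (smul_enum_mem_semigroupB p hi hn)
    rwa [map_smul, Calkin.norm_smul, Complex.norm_real, Real.norm_of_nonneg (by positivity)] at h3
  have h2 : Filter.Tendsto (fun n : ℕ => (n : ℝ) / (n + 1) * ‖f z‖)
      Filter.atTop (nhds (1 * ‖f z‖)) :=
    (tendsto_natCast_div_add_atTop (1 : ℝ)).mul_const _
  rw [one_mul] at h2
  exact le_of_tendsto h2 (Filter.eventually_atTop.2 ⟨i, h1⟩)

/-- For rational `q` slightly above `‖φ‖`, the function `φ / q` is some `φ_i`. -/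
theorem norm_algHom_le_of_mem_A
    (hf : ∀ φ : lipAlgebra p, ∀ n, 1 ≤ n → (φ : C(K, ℂ)) ∈ semigroupB p.enum n → ‖f φ‖ ≤ 1)
    {φ : lipAlgebra p} (h : (φ : C(K, ℂ)) ∈ p.A) : ‖f φ‖ ≤ ‖φ‖ := by
  refine le_of_forall_gt_imp_ge_of_dense fun r hr => ?_
  obtain ⟨q, hq, hqr⟩ := exists_rat_btwn hr
  have hq0 : (0 : ℝ) < q := (norm_nonneg φ).trans_lt hq
  obtain ⟨i, hi, e⟩ := exists_enum_eq p h (by exact_mod_cast hq0) hq.le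
  have e' : φ = (q : ℂ) • (⟨p.enum i, isLip_enum p hi⟩ : lipAlgebra p) := Subtype.ext e
  rw [e', map_smul, Calkin.norm_smul, Complex.norm_ratCast, abs_of_pos hq0]
  exact (mul_le_of_le_one_right hq0.le (norm_algHom_enum_le hf hi)).trans hqr.le

theorem norm_le_norm_algHom
    (hf : ∀ φ : lipAlgebra p, ∀ n, 1 ≤ n → ∀ κ ∈ p.net n, ‖(φ : C(K, ℂ)) κ‖ ≤ ‖f φ‖)
    (φ : lipAlgebra p) : ‖φ‖ ≤ ‖f φ‖ := by
  obtain ⟨L, hL0, hL⟩ := IsLip.exists_nonneg φ.2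
  refine (ContinuousMap.norm_le _ (norm_nonneg _)).2 fun κ => ?_
  have h1 : ∀ n : ℕ, ‖(φ : C(K, ℂ)) κ‖ ≤ ‖f φ‖ + L * ((2 : ℝ) ^ (n + 2))⁻¹ := fun n => by
    obtain ⟨y, hy, hρ⟩ := p.net_net (n + 1) (by omega) κ
    have h2 : rho p.enum κ y ≤ ((2 : ℝ) ^ (n + 2))⁻¹ := by
      refine hρ.trans (mul_le_of_le_one_left (by positivity) ?_)
      exact (inv_m_le (p := p) (by omega)).trans (by norm_num)
    have h3 := norm_le_norm_add_norm_sub' ((φ : C(K, ℂ)) κ) ((φ : C(K, ℂ)) y)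
    have h4 := hf φ (n + 1) (by omega) y hy
    have h5 := (hL κ y).trans (mul_le_mul_of_nonneg_left h2 hL0)
    linarith
  have h2 : Filter.Tendsto (fun n : ℕ => ‖f φ‖ + L * ((2 : ℝ) ^ (n + 2))⁻¹)
      Filter.atTop (nhds (‖f φ‖ + L * 0)) := by
    refine tendsto_const_nhds.add (Filter.Tendsto.const_mul L ?_)
    exact (tendsto_inv_atTop_zero.comp (tendsto_pow_atTop_atTop_of_one_lt one_lt_two)).comp
      (Filter.tendsto_add_atTop_nat 2)
  simpa using ge_of_tendsto' h2 h1

theorem norm_extension_eq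
    (hup : ∀ φ : lipAlgebra p, ∀ n, 1 ≤ n → (φ : C(K, ℂ)) ∈ semigroupB p.enum n → ‖f φ‖ ≤ 1)
    (hlow : ∀ φ : lipAlgebra p, ∀ n, 1 ≤ n → ∀ κ ∈ p.net n, ‖(φ : C(K, ℂ)) κ‖ ≤ ‖f φ‖)
    {Ψ : C(K, ℂ) → Calkin E} (hc : Continuous Ψ) (h : ∀ φ : lipAlgebra p, Ψ φ = f φ)
    (φ : C(K, ℂ)) : ‖Ψ φ‖ = ‖φ‖ := by
  have hn : Continuous fun φ => ‖Ψ φ‖ := continuous_norm.comp hc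
  have hA : Set.EqOn (fun φ => ‖Ψ φ‖) (fun φ => ‖φ‖) p.A := fun g hg => by
    have e := h ⟨g, isLip_of_mem_A hg⟩
    have e' := le_antisymm (norm_algHom_le_of_mem_A hup (φ := ⟨g, isLip_of_mem_A hg⟩) hg)
      (norm_le_norm_algHom hlow _)
    rw [← e] at e'
    exact e'
  exact congrFun (Continuous.ext_on p.A_dense hn continuous_norm hA) φ

end LipHom

end Calkin

/-! ### The equivalent norm -/

section TailNorm

variable (c) in
/-- The operator `P_{(n, ∞)} φ̂`. -/
def tailHat (n : ℕ) {φ : C(K, ℂ)} (h : IsLip p φ) : X c →L[ℂ] X c :=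
  hat c h - (projX c n).comp (hat c h)

theorem tailHat_apply (n : ℕ) {φ : C(K, ℂ)} (h : IsLip p φ) (x : X c) :
    tailHat c n h x = hat c h x - projX c n (hat c h x) := rfl

theorem norm_tailHat_le {φ : C(K, ℂ)} (h : IsLip p φ) {M L : ℝ} (hM : ‖φ‖ ≤ M)
    (hL0 : 0 ≤ L) (hL : ∀ x y, ‖φ x - φ y‖ ≤ L * rho p.enum x y) (n : ℕ) (x : X c) :
    ‖tailHat c n h x‖ ≤ 19 * (M + L / 2 ^ (n + 1)) * ‖x‖ := by
  have h1 := norm_hatLInf_sub_proj_le (c := c) h hM hL0 hL n (x : LInf c)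
  exact h1

theorem hat_hat {φ ψ : C(K, ℂ)} (hφ : IsLip p φ) (hψ : IsLip p ψ) (h : IsLip p (φ * ψ))
    (x : X c) : hat c hφ (hat c hψ x) = hat c h x := by
  have := ((isHat_hat (c := c) hφ).comp (isHat_hat hψ)).eq_hat h
  rw [← this, mul_apply_eq_comp]

/-- The diagonal operators commute with the projections, so the product is `φ̂ψ̂` cut at the later
of the two ranks. -/
theorem tailHat_tailHat {φ ψ : C(K, ℂ)} (hφ : IsLip p φ) (hψ : IsLip p ψ) (h : IsLip p (φ * ψ))
    (n m : ℕ) (x : X c) :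
    tailHat c n hφ (tailHat c m hψ x) = tailHat c (max n m) h x := by
  rw [tailHat_apply, tailHat_apply, tailHat_apply, ContinuousLinearMap.map_sub,
    ContinuousLinearMap.map_sub, ← projX_hat, hat_hat hφ hψ h, projX_projX]
  rcases le_total n m with h' | h'
  · rw [max_eq_right h', min_eq_left h']; abel
  · rw [max_eq_left h', min_eq_right h']; abel

theorem calkinHom_tailHat (ν : EquivalentNorm (X c)) (n : ℕ) {φ : C(K, ℂ)} (h : IsLip p φ) :
    calkinHom ν (tailHat c n h) = calkinHom ν (hat c h) :=
  calkinHom_sub_of_isCompactOperator ν _ ((isCompactOperator_projX n).comp_clm (hat c h))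

variable (p) in
/-- The pairs of `n ≥ 1` and `φ ∈ 𝓑_n`. -/
abbrev TailIndex : Type u := {q : ℕ × C(K, ℂ) // 1 ≤ q.1 ∧ q.2 ∈ semigroupB p.enum q.1}

theorem TailIndex.isLip (q : TailIndex p) : IsLip p q.1.2 := isLip_of_mem_semigroupB q.2.1 q.2.2

variable (c) in
/-- The operators whose supremum defines the new norm. -/
def normingOp : Option (TailIndex p) → X c →L[ℂ] X c
  | none => .id ℂ (X c)
  | some q => tailHat c q.1.1 q.isLip

theorem norm_normingOp_le (i : Option (TailIndex p)) (x : X c) :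
    ‖normingOp c i x‖ ≤ 29 * ‖x‖ := by
  cases i with
  | none =>
    change ‖x‖ ≤ _
    linarith [norm_nonneg x]
  | some q =>
    refine (norm_tailHat_le q.isLip (norm_le_one_of_mem_semigroupB q.2.2) (by positivity)
      (norm_sub_le_rho q.2.1 q.2.2) q.1.1 x).trans ?_
    -- The cut at rank `n` balances the Lipschitz constant `2^n`, giving `19 (1 + 1/2) ≤ 29` for all
    -- `n`.
    have : (2 : ℝ) ^ q.1.1 / 2 ^ (q.1.1 + 1) = 1 / 2 := by
      rw [pow_succ]; field_simp
    rw [this]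
    gcongr
    norm_num

theorem bddAbove_normingOp (x : X c) :
    BddAbove (Set.range fun i : Option (TailIndex p) => ‖normingOp c i x‖) := by
  refine ⟨29 * ‖x‖, ?_⟩
  rintro _ ⟨i, rfl⟩
  exact norm_normingOp_le i x

variable (c) in
/-- The seminorm `x ↦ sup ({‖x‖} ∪ {‖P_{(n, ∞)} φ̂ x‖ : n ≥ 1, φ ∈ 𝓑_n})`. -/
def tailSeminorm : Seminorm ℂ (X c) :=
  ⨆ i, (normSeminorm ℂ (X c)).comp (normingOp c i).toLinearMap

theorem tailSeminorm_apply (x : X c) : tailSeminorm c x = ⨆ i, ‖normingOp c i x‖ :=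
  Seminorm.iSup_apply (Seminorm.bddAbove_range_iff.2 bddAbove_normingOp)

theorem norm_normingOp_le_tailSeminorm (i : Option (TailIndex p)) (x : X c) :
    ‖normingOp c i x‖ ≤ tailSeminorm c x := by
  rw [tailSeminorm_apply]
  exact le_ciSup (bddAbove_normingOp x) i

theorem tailSeminorm_le {x : X c} {C : ℝ} (h : ∀ i, ‖normingOp c i x‖ ≤ C) :
    tailSeminorm c x ≤ C := by
  rw [tailSeminorm_apply]
  exact ciSup_le h

variable (c) in
/-- The equivalent norm `|||·|||`. -/
def tailNorm : EquivalentNorm (X c) where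
  toSeminorm := tailSeminorm c
  lower := ⟨1, one_pos, fun x => by
    rw [one_mul]; exact norm_normingOp_le_tailSeminorm none x⟩
  upper := ⟨29, fun x => tailSeminorm_le fun i => norm_normingOp_le i x⟩

/-- With `N(n) = n + 1` the projection `P_{[N(n),∞)}` is `id - P_{[1,n]}`, the cut made in `tailHat
c n`. -/
theorem isTailNorm_tailNorm : IsTailNorm c (fun n => n + 1) (tailNorm c) := by
  refine ⟨fun n hn φ hφ => ⟨_, isHat_hat (isLip_of_mem_semigroupB hn hφ)⟩, fun x => ?_⟩
  refine ⟨?_, fun C hC => tailSeminorm_le fun i => ?_⟩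
  · rintro r (rfl | ⟨n, hn, φ, hφ, T, hT, rfl⟩)
    · exact norm_normingOp_le_tailSeminorm none x
    · rw [hT.eq_hat (isLip_of_mem_semigroupB hn hφ)]
      exact norm_normingOp_le_tailSeminorm (some ⟨(n, φ), hn, hφ⟩) x
  · cases i with
    | none => exact hC (.inl rfl)
    | some q => exact hC (.inr ⟨q.1.1, q.2.1, q.1.2, q.2.2, hat c q.isLip, isHat_hat _, rfl⟩)

theorem tailSeminorm_tailHat_le {n : ℕ} (hn : 1 ≤ n) {φ : C(K, ℂ)}
    (hφ : φ ∈ semigroupB p.enum n) (x : X c) :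
    tailSeminorm c (tailHat c n (isLip_of_mem_semigroupB hn hφ) x) ≤ tailSeminorm c x := by
  refine tailSeminorm_le fun i => ?_
  cases i with
  | none => exact norm_normingOp_le_tailSeminorm (some ⟨(n, φ), hn, hφ⟩) x
  | some q =>
    have hmem : q.1.2 * φ ∈ semigroupB p.enum (max q.1.1 n) :=
      mul_mem_semigroupB (semigroupB_mono p (le_max_left _ _) q.2.2)
        (semigroupB_mono p (le_max_right _ _) hφ)
    have hmax : 1 ≤ max q.1.1 n := hn.trans (le_max_right _ _)
    have e : normingOp c (some q) (tailHat c n (isLip_of_mem_semigroupB hn hφ) x) =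
        normingOp c (some ⟨(max q.1.1 n, q.1.2 * φ), hmax, hmem⟩) x :=
      tailHat_tailHat q.isLip _ (isLip_of_mem_semigroupB hmax hmem) q.1.1 n x
    rw [e]
    exact norm_normingOp_le_tailSeminorm _ x

end TailNorm

/-! ### The homomorphism `Ψ` -/

section Psi

variable (c) in
/-- `φ ↦ φ̂` on the `ϱ`-Lipschitz functions. -/
def hatHom : lipAlgebra p →ₐ[ℂ] (X c →L[ℂ] X c) :=
  AlgHom.ofLinearMap
    { toFun := fun φ => hat c φ.2
      map_add' := fun φ ψ => IsHat.unique (isHat_hat (φ + ψ).2) fun γ => by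
        rw [add_apply, isHat_hat φ.2, isHat_hat ψ.2, ← add_smul]; rfl
      map_smul' := fun a φ => IsHat.unique (isHat_hat (a • φ).2) fun γ => by
        rw [RingHom.id_apply, smul_apply, isHat_hat φ.2, smul_smul]; rfl }
    (IsHat.unique (isHat_hat (1 : lipAlgebra p).2) fun γ => by simp)
    (fun φ ψ => IsHat.unique (isHat_hat (φ * ψ).2) ((isHat_hat φ.2).comp (isHat_hat ψ.2)))

variable (c) in
/-- `φ ↦ [φ̂]` on the `ϱ`-Lipschitz functions. -/
def hatClass (ν : EquivalentNorm (X c)) : lipAlgebra p →ₐ[ℂ] Calkin (Renormed ν) :=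
  (calkinHom ν).comp (hatHom c)

theorem hatClass_apply (ν : EquivalentNorm (X c)) (φ : lipAlgebra p) (h : IsLip p φ) :
    hatClass c ν φ = calkinHom ν (hat c h) := rfl

/-- All tails of `φ̂` have the same class, so the Lipschitz term `L / 2^{n+1}` can be sent to 0,
leaving a constant independent of `φ`. -/
theorem exists_norm_hatClass_le (ν : EquivalentNorm (X c)) :
    ∃ C : ℝ, ∀ φ : lipAlgebra p, ‖hatClass c ν φ‖ ≤ C * ‖φ‖ := by
  obtain ⟨D, hD0, hD⟩ := exists_norm_calkinHom_le ν
  refine ⟨D * 19, fun φ => ?_⟩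
  obtain ⟨L, hL0, hL⟩ := IsLip.exists_nonneg φ.2
  have h0 : IsLip p φ := φ.2
  have h1 : ∀ n : ℕ, ‖hatClass c ν φ‖ ≤ D * (19 * (‖φ‖ + L / 2 ^ (n + 1))) := fun n => by
    rw [hatClass_apply ν φ h0, ← calkinHom_tailHat ν n]
    exact hD _ _ (by positivity) (norm_tailHat_le h0 le_rfl hL0 hL n)
  have h2 : Filter.Tendsto (fun n : ℕ => D * (19 * (‖φ‖ + L / 2 ^ (n + 1)))) Filter.atTop
      (nhds (D * (19 * (‖φ‖ + 0)))) := by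
    refine ((tendsto_const_nhds.add ?_).const_mul 19).const_mul D
    exact (tendsto_const_nhds.div_atTop (tendsto_pow_atTop_atTop_of_one_lt one_lt_two)).comp
      (Filter.tendsto_add_atTop_nat 1)
  refine (ge_of_tendsto' h2 h1).trans (le_of_eq ?_)
  ring

theorem isPsi_iff {ν : EquivalentNorm (X c)} {Ψ : C(K, ℂ) → Calkin (Renormed ν)} :
    IsPsi c ν Ψ ↔ Continuous Ψ ∧ ∀ φ : lipAlgebra p, Ψ φ = hatClass c ν φ := by
  refine and_congr_right fun _ => ⟨fun h φ => ?_, fun h φ hφ => ⟨_, isHat_hat hφ, h ⟨φ, hφ⟩⟩⟩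
  obtain ⟨T, hT, e⟩ := h φ φ.2
  rw [e, hT.eq_hat φ.2]
  rfl

theorem IsPsi.unique {ν : EquivalentNorm (X c)} {Ψ Ψ' : C(K, ℂ) → Calkin (Renormed ν)}
    (h : IsPsi c ν Ψ) (h' : IsPsi c ν Ψ') : Ψ = Ψ' := by
  rw [isPsi_iff] at h h'
  exact Continuous.ext_on (dense_lipAlgebra p) h.1 h'.1 fun φ hφ =>
    (h.2 ⟨φ, hφ⟩).trans (h'.2 ⟨φ, hφ⟩).symm

theorem exists_isPsi (ν : EquivalentNorm (X c)) :
    ∃ Ψ : C(K, ℂ) →ₐ[ℂ] Calkin (Renormed ν), IsPsi c ν Ψ := by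
  obtain ⟨C, hC⟩ := exists_norm_hatClass_le ν
  obtain ⟨Ψ, h⟩ := exists_algHom_extension (lipAlgebra p) (dense_lipAlgebra p) (hatClass c ν) C hC
  exact ⟨Ψ, isPsi_iff.2 h⟩

theorem net_subset (p : Params K) {n m : ℕ} (hn : 1 ≤ n) (h : n ≤ m) : p.net n ⊆ p.net m := by
  induction m, h using Nat.le_induction with
  | base => exact subset_rfl
  | succ m hm ih => exact ih.trans (p.net_mono m (hn.trans hm))

theorem norm_apply_net_le (ν : EquivalentNorm (X c)) (φ : lipAlgebra p) (n : ℕ) (hn : 1 ≤ n)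
    (κ : K) (hκ : κ ∈ p.net n) : ‖(φ : C(K, ℂ)) κ‖ ≤ ‖hatClass c ν φ‖ := by
  -- The nets increase, so `κ` carries a weight-0 node at every rank from `n` on. The `d_γ` of these
  -- nodes are 1-separated, as seen by evaluating at the node of smaller rank.
  let g : ℕ → Gam c := fun k =>
    ⟨.base (n + k) κ, by omega, net_subset p hn (Nat.le_add_right n k) hκ⟩
  refine norm_le_norm_calkinHom_of_eigenvectors ν (v := fun k => basisVec c (g k))
    (fun k => isHat_hat φ.2 (g k)) (fun k => norm_basisVec_le (g k)) one_pos fun k l hkl => ?_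
  have h := lp.norm_apply_le_norm (p := ∞) (by simp)
    ((basisVec c (g k) - basisVec c (g l) : X c) : LInf c) (g k)
  have hlt : (g k).1.rank < (g l).1.rank := by
    change n + k < n + l
    omega
  rw [Submodule.coe_sub, lp.coeFn_sub, Pi.sub_apply, basisVec_apply_self,
    basisVec_apply_of_rank_lt hlt, sub_zero, norm_one] at h
  exact h

theorem norm_hatClass_le_one {ν : EquivalentNorm (X c)} (hν : ν.toSeminorm = tailSeminorm c)
    (φ : lipAlgebra p) (n : ℕ) (hn : 1 ≤ n) (hφ : (φ : C(K, ℂ)) ∈ semigroupB p.enum n) :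
    ‖hatClass c ν φ‖ ≤ 1 := by
  rw [hatClass_apply ν φ (isLip_of_mem_semigroupB hn hφ), ← calkinHom_tailHat ν n]
  refine norm_calkinHom_le ν zero_le_one fun x => ?_
  rw [one_mul, hν]
  exact tailSeminorm_tailHat_le hn hφ x

theorem norm_apply_eq_of_isPsi {ν : EquivalentNorm (X c)} (hν : ν.toSeminorm = tailSeminorm c)
    {Ψ : C(K, ℂ) → Calkin (Renormed ν)} (h : IsPsi c ν Ψ) (φ : C(K, ℂ)) : ‖Ψ φ‖ = ‖φ‖ :=
  norm_extension_eq (norm_hatClass_le_one hν) (norm_apply_net_le ν) (isPsi_iff.1 h).1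
    (isPsi_iff.1 h).2 φ

end Psi

end CKCalkin

end
theorem mainTheorem5 {K : Type*} [MetricSpace K] [CompactSpace K]
    (p : CKCalkin.Params K) (c : CKCalkin.Coding p) :
    ∃ (ν : CKCalkin.EquivalentNorm (CKCalkin.X c)) (N : ℕ → ℕ)
      (Ψ : C(K, ℂ) →ₐ[ℂ] CKCalkin.Calkin (CKCalkin.Renormed ν)),
      Monotone N ∧ (∀ n, 1 ≤ N n) ∧ CKCalkin.IsTailNorm c N ν ∧
      CKCalkin.IsPsi c ν Ψ ∧
      (∀ Ψ' : C(K, ℂ) → CKCalkin.Calkin (CKCalkin.Renormed ν), CKCalkin.IsPsi c ν Ψ' → Ψ' = Ψ) ∧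
      (∀ φ : C(K, ℂ), ‖Ψ φ‖ = ‖φ‖) := by
  obtain ⟨Ψ, hΨ⟩ := CKCalkin.exists_isPsi (CKCalkin.tailNorm c)
  exact ⟨CKCalkin.tailNorm c, fun n => n + 1, Ψ, fun _ _ h => Nat.add_le_add_right h 1,
    fun n => Nat.le_add_left 1 n, CKCalkin.isTailNorm_tailNorm, hΨ, fun _ h => h.unique hΨ,
    CKCalkin.norm_apply_eq_of_isPsi rfl hΨ⟩
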